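/- **Definitions.** Let $F$ be a profinite group. All homomorphisms between profinite groups are continuous. - A subset $X\subseteq F$ *converges to $1$* if every open normal subgroup of $F$ contains all but finitely many elements of $X$; $\operatorname{rank}(F)$ is the least cardinality of a set of topological generators of $F$ converging to $1$. "Finitely generated" means topologically finitely generated. - A *finite embedding problem* for $F$ is a pair of epimorphisms $(\varphi\colon F\to G,\ \alpha\colon H\to G)$ with $G,H$ finite. It is *split* if there is a homomorphism $\beta\colon G\to H$ with $\alpha\circ\beta=\mathrm{id}_G$, and *nontrivial* if $\alpha$ is not an isomorphism. A *proper solution* is a surjective homomorphism $\psi\colon F\to H$ with $\alpha\circ\psi=\varphi$. - A family $(M_i)_{i\in I}$ of open subgroups of a profinite group $K$ is *$K$-independent* if $(K:\bigcap_{i\in J}M_i)=\prod_{i\in J}(K:M_i)$ for every finite $J\subseteq I$. A set of solutions of a finite embedding problem is *independent* if the family of their kernels, indexed by the solutions, is $\operatorname{Ker}\varphi$-independent. - A profinite group $F$ of infinite rank $m$ is *semi-free* (of rank $m$) if every nontrivial finite split embedding problem for $F$ has a set of $m$ independent proper solutions. - For a closed subgroup $M\le F$: $\operatorname{weight}(F/M)$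 is $1$ if $M$ is open in $F$, and otherwise is the cardinality of the set of open subgroups of $F$ containing $M$. The index $(F:M)$ is the supernatural number $\prod_p p^{\alpha(p)}$, $0\le\alpha(p)\le\infty$, which is the least common multiple of the indices $(F:U)$ of all open subgroups $U$ of $F$ containing $M$. - A closed subgroup $M$ of infinite index in $F$ is *sparse* in $F$ if for every $n\in\mathbb N$ there exists an open subgroup $K$ of $F$ containing $M$ such that $(K:L)\ge n$ for every proper open subgroup $L$ of $K$ containing $M$. **Theorem.** Let $F$ be a semi-free profinite group of infinite rank $m$ and let $M$ be a closed subgroup of $F$. Then $M$ is semi-free of rank $m$ in each of the following cases. (I) $(F:M)<\infty$. (II) $F/\hat M$ is finitely generated, where $\hat M=\bigcap_{\sigma\in F}M^\sigma$ is the normal core of $M$ in $F$. (III) $\operatorname{weight}(F/M)<m$. (IV) $M$ is a proper subgroup of finite index of a closed normal subgroup of $F$. (V) $M$ is normal in $F$, and $F/M$ is abelian. (VI) There exist closed normal subgroups $M_1,M_2$ of $F$ such that $M_1\cap M_2\le M$ but $M_1\not\le M$ and $M_2\not\le M$. (VII) $M$ contains a closed normal subgroup $N$ of $F$ such that $F/N$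 is pronilpotent (that is, an inverse limit of finite nilpotent groups), and $(F:M)$ is divisible by at least two primes. (VIII) $M$ is sparse in $F$. (IX) $(F:M)=\prod_p p^{\alpha(p)}$ with $\alpha(p)<\infty$ for all primes $p$. -/

import Mathlib

open Cardinal

universe u

namespace SemiFree

section Basics

variable {G : Type u} [Group G] [TopologicalSpace G] [IsTopologicalGroup G]

/-- The subset `X` generates `G` topologically. -/
def TopologicallyGenerates (X : Set G) : Prop :=
  (Subgroup.closure X).topologicalClosure = ⊤

/-- The subset `X` converges to `1`: every open normal subgroup contains all but finitely many
elements of `X`. -/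
def ConvergesToOne (X : Set G) : Prop :=
  ∀ U : Subgroup G, U.Normal → IsOpen (U : Set G) → (X \ (U : Set G)).Finite

variable (G) in
/-- The rank of a profinite group: the least cardinality of a set of topological generators
converging to `1`. -/
noncomputable def rank : Cardinal.{u} :=
  sInf {c | ∃ X : Set G, TopologicallyGenerates X ∧ ConvergesToOne X ∧ #X = c}

variable (G) in
/-- `G` is (topologically) finitely generated. -/
def TopologicallyFG : Prop :=
  ∃ X : Set G, X.Finite ∧ TopologicallyGenerates X

variable (G) in
/-- A profinite group is pronilpotent if all its quotients by open normal subgroups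
are nilpotent. -/
def IsPronilpotent : Prop :=
  ∀ (U : Subgroup G) [U.Normal], IsOpen (U : Set G) → Group.IsNilpotent (G ⧸ U)

end Basics

/-- An indexed family of (open) subgroups of `G` is `G`-independent if, for each finite subfamily,
the index of the intersection is the product of the indices. -/
def IndependentSubgroups {G : Type*} [Group G] {ι : Type*} (M : ι → Subgroup G) : Prop :=
  ∀ s : Finset ι, (⨅ i ∈ s, M i).index = ∏ i ∈ s, (M i).index

section EmbeddingProblems

variable {F : Type u} [Group F] [TopologicalSpace F]

variable (F) in
/-- A finite embedding problem `(φ : F → G, α : H → G)` for `F`; the finite groups `G` and `H`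
carry the discrete topology. -/
structure FiniteEmbeddingProblem where
  G : Type u
  H : Type u
  [groupG : Group G]
  [groupH : Group H]
  [finiteG : Finite G]
  [finiteH : Finite H]
  [topG : TopologicalSpace G]
  [topH : TopologicalSpace H]
  [discreteG : DiscreteTopology G]
  [discreteH : DiscreteTopology H]
  φ : F →ₜ* G
  α : H →* G
  φ_surjective : Function.Surjective φ
  α_surjective : Function.Surjective α

namespace FiniteEmbeddingProblem

attribute [instance] groupG groupH finiteG finiteH topG topH discreteG discreteH

/-- The epimorphism `α` has a section that is a homomorphism. -/
def IsSplit (E : FiniteEmbeddingProblem F) : Prop :=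
  ∃ β : E.G →* E.H, ∀ g, E.α (β g) = g

/-- The epimorphism `α` is not an isomorphism. -/
def IsNontrivial (E : FiniteEmbeddingProblem F) : Prop :=
  ¬ Function.Bijective E.α

/-- A (weak) solution: a continuous homomorphism `ψ : F → H` with `α ∘ ψ = φ`. -/
def IsSolution (E : FiniteEmbeddingProblem F) (ψ : F →ₜ* E.H) : Prop :=
  ∀ x, E.α (ψ x) = E.φ x

/-- A proper solution: a surjective solution. -/
def IsProperSolution (E : FiniteEmbeddingProblem F) (ψ : F →ₜ* E.H) : Prop :=
  E.IsSolution ψ ∧ Function.Surjective ψ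

/-- A set of solutions is independent if their kernels, as a family indexed by the solutions,
are `Ker φ`-independent. (Two different solutions with the same kernel count twice.) -/
def IndependentSolutions (E : FiniteEmbeddingProblem F) (Ψ : Set (F →ₜ* E.H)) : Prop :=
  IndependentSubgroups fun ψ : Ψ =>
    ((ψ : F →ₜ* E.H) : F →* E.H).ker.subgroupOf (E.φ : F →* E.G).ker

end FiniteEmbeddingProblem

end EmbeddingProblems

/-- A profinite group `F` is semi-free if its rank is infinite and each nontrivial finite split
embedding problem for `F` has `rank F` independent proper solutions. -/
def IsSemiFree (F : Type u) [Group F] [TopologicalSpace F] [IsTopologicalGroup F] : Prop :=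
  ℵ₀ ≤ rank F ∧
    ∀ E : FiniteEmbeddingProblem F, E.IsSplit → E.IsNontrivial →
      ∃ Ψ : Set (F →ₜ* E.H),
        #Ψ = rank F ∧ (∀ ψ ∈ Ψ, E.IsProperSolution ψ) ∧ E.IndependentSolutions Ψ

section Subgroups

variable {F : Type u} [Group F] [TopologicalSpace F]

open Classical in
/-- `weight (F / M)` for a closed subgroup `M`: it is `1` if `M` is open, and otherwise it is the
cardinality of the set of open subgroups of `F` that contain `M`. -/
noncomputable def weight (M : Subgroup F) : Cardinal.{u} :=
  if IsOpen (M : Set F) then 1 else #{U : Subgroup F // IsOpen (U : Set F) ∧ M ≤ U}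

/-- A subgroup `M` of `F` is sparse if it is closed of infinite index and, for all `n`, there is an
open subgroup `K` containing `M` such that every proper open subgroup `L` of `K` that contains `M`
satisfies `(K : L) ≥ n`. -/
def IsSparse (M : Subgroup F) : Prop :=
  IsClosed (M : Set F) ∧ ¬ M.FiniteIndex ∧
    ∀ n : ℕ, ∃ K : Subgroup F, IsOpen (K : Set F) ∧ M ≤ K ∧
      ∀ L : Subgroup F, IsOpen (L : Set F) → M ≤ L → L < K → n ≤ L.relIndex K

/-- The exponent of the prime `p` in the supernatural number `(F : M)`, for `M` closed in a
profinite group `F`; here `(F : M)` is the least common multiple of the (finite) indices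
`(F : U)` of the open subgroups `U` of `F` that contain `M`. -/
noncomputable def indexExponent (M : Subgroup F) (p : Nat.Primes) : ℕ∞ :=
  ⨆ (U : Subgroup F) (_ : IsOpen (U : Set F) ∧ M ≤ U), (padicValNat p U.index : ℕ∞)

end Subgroups

end SemiFree

/-! Independence of solutions means that finitely many of them map Ker φ onto a full power of Ker α
(`independentSubgroups_iff_jointlyOnto`), so the task is to build `m` solutions over `M` with this
property.

Let `A` be the kernel of a split problem for `M`, and let `L` be an open normal subgroup of `F` with
`L ∩ M` inside Ker φ. The `A`-valued functions on `F/L` that are equivariant under `ML/L` form, with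
`F/L`, a twisted wreath product, hence a split problem for `F`. Semi-freeness gives `m` independent
solutions of it. Evaluating their function part at `1` and restricting to `M` gives solutions for
`M` (`IsSemiFree.exists_wreath_family`). It remains to reach arbitrary values in `A` by elements of
`M ∩ L`, not just of `L`.

There are two ways to do so. If commutators with suitable elements outside `M` fall into `M`, they
move elements of `L` into `M` without changing the value at `1`: simple commutators serve abelian
quotients, double ones the diamond case, to which the pronilpotent case and proper finite-index
subgroups of normal subgroups reduce. If few homomorphisms to finite groups kill the normal core of
`M` up to open subgroups, a maximal subfamily independent on the core still has `m` members
(`FewHoms.exists_jointlyOnto`); this serves open subgroups, finitely generated quotients and small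
weight.

A sparse subgroup has countable weight, so only `m = ℵ₀` is left. There one proper solution per
problem suffices, and a proper solution over a suitable open `K ≥ M` stays onto on `M`. Finite
exponents make the index finite or the subgroup sparse. -/

namespace SemiFree

/-! ### Independence as joint surjectivity. -/

/-- For each finite subfamily of `ψ`, the joint map `K → ∏ A` is onto. -/
def JointlyOnto {F H ι : Type*} [Group F] [Group H] (K : Subgroup F) (A : Subgroup H)
    (ψ : ι → F → H) : Prop :=
  ∀ (J : Finset ι) (a : ι → H), (∀ i, a i ∈ A) → ∃ x ∈ K, ∀ i ∈ J, ψ i x = a i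

lemma JointlyOnto.comp {F H ι κ : Type*} [Group F] [Group H] {K : Subgroup F} {A : Subgroup H}
    {ψ : ι → F → H} (h : JointlyOnto K A ψ) {f : κ → ι} (hf : Function.Injective f) :
    JointlyOnto K A (ψ ∘ f) := by
  classical
  intro J a ha
  rcases isEmpty_or_nonempty κ with hκ | hκ
  · exact ⟨1, K.one_mem, fun i => hκ.elim i⟩
  obtain ⟨x, hx, h'⟩ := h (J.image f) (a ∘ Function.invFun f) (fun i => ha _)
  refine ⟨x, hx, fun i hi => ?_⟩
  rw [Function.comp_apply, h' _ (Finset.mem_image_of_mem f hi), Function.comp_apply,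
    Function.leftInverse_invFun hf]

lemma JointlyOnto.injective {F H ι : Type*} [Group F] [Group H] {K : Subgroup F}
    {A : Subgroup H} {ψ : ι → F → H} (h : JointlyOnto K A ψ) (hA : A ≠ ⊥) :
    Function.Injective ψ := by
  classical
  intro i j hij
  by_contra hne
  obtain ⟨a, ha, ha1⟩ := A.bot_or_exists_ne_one.resolve_left hA
  obtain ⟨x, -, hx⟩ := h {i, j} (fun k => if k = i then a else 1)
    (fun k => by split_ifs; exacts [ha, A.one_mem])
  have h1 := hx i (by simp)
  have h2 := hx j (by simp)
  rw [hij, h2] at h1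
  simp [Ne.symm hne] at h1
  exact ha1 h1.symm

/-- Joint surjectivity on a kernel is independence of the kernels. -/
lemma independentSubgroups_iff_jointlyOnto {F H ι : Type*} [Group F] [Group H] [Finite H]
    {K : Subgroup F} {A : Subgroup H} (ψ : ι → F →* H) (hψ : ∀ i, K.map (ψ i) = A) :
    IndependentSubgroups (fun i => (ψ i).ker.subgroupOf K) ↔
      JointlyOnto K A (fun i => (ψ i : F → H)) := by
  classical
  have hmem : ∀ i (x : K), ψ i x ∈ A := fun i x => hψ i ▸ Subgroup.mem_map_of_mem _ x.2
  let θ : ι → K →* A := fun i => ((ψ i).comp K.subtype).codRestrict A (hmem i)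
  have hθ : ∀ i, (ψ i).ker.subgroupOf K = (θ i).ker := by
    intro i; ext x
    exact (Subtype.ext_iff (a1 := θ i x) (a2 := 1)).symm
  have hθs : ∀ i, Function.Surjective (θ i) := by
    rintro i ⟨a, ha⟩
    rw [← hψ i] at ha
    obtain ⟨x, hx, rfl⟩ := ha
    exact ⟨⟨x, hx⟩, rfl⟩
  have hind : ∀ i, ((ψ i).ker.subgroupOf K).index = Nat.card A := by
    intro i
    rw [hθ, Subgroup.index_ker, MonoidHom.range_eq_top.2 (hθs i), Subgroup.card_top]
  -- The left index is the order of the image of `K` in `A ^ s`, the product is the order of `A ^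
  -- s`; equality of finite orders is surjectivity.
  have key : ∀ s : Finset ι, (⨅ i ∈ s, (ψ i).ker.subgroupOf K).index =
      ∏ i ∈ s, ((ψ i).ker.subgroupOf K).index ↔
      Function.Surjective (MonoidHom.pi fun i : s => θ i) := by
    intro s
    have h1 : (⨅ i ∈ s, (ψ i).ker.subgroupOf K) = (MonoidHom.pi fun i : s => θ i).ker := by
      ext x
      simp only [hθ, Subgroup.mem_iInf, MonoidHom.mem_ker, funext_iff, MonoidHom.pi_apply,
        Pi.one_apply, Subtype.forall]
    rw [h1, Subgroup.index_ker, Finset.prod_congr rfl (fun i _ => hind i), Finset.prod_const,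
      ← MonoidHom.range_eq_top, ← Subgroup.card_eq_iff_eq_top, Nat.card_pi]
    simp
  simp only [IndependentSubgroups, key]
  constructor
  · intro h J a ha
    obtain ⟨x, hx⟩ := h J (fun i => ⟨a i, ha i⟩)
    refine ⟨x, x.2, fun i hi => ?_⟩
    have := congrFun hx ⟨i, hi⟩
    exact congrArg Subtype.val this
  · intro h J b
    obtain ⟨x, hx, h'⟩ := h J (fun i => if hi : i ∈ J then (b ⟨i, hi⟩ : H) else 1)
      (fun i => by split_ifs; exacts [(b _).2, A.one_mem])
    refine ⟨⟨x, hx⟩, ?_⟩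
    ext ⟨i, hi⟩
    have := h' i hi
    rw [dif_pos hi] at this
    exact this

namespace FiniteEmbeddingProblem

variable {F : Type u} [Group F] [TopologicalSpace F]

lemma ker_ne_bot {E : FiniteEmbeddingProblem F} (hE : E.IsNontrivial) : E.α.ker ≠ ⊥ := by
  intro h
  exact hE ⟨(MonoidHom.ker_eq_bot_iff _).1 h, E.α_surjective⟩

lemma IsProperSolution.map_ker {E : FiniteEmbeddingProblem F} {ψ : F →ₜ* E.H}
    (h : E.IsProperSolution ψ) :
    (E.φ : F →* E.G).ker.map (ψ : F →* E.H) = E.α.ker := by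
  ext a
  constructor
  · rintro ⟨x, hx, rfl⟩
    exact (h.1 x).trans hx
  · intro ha
    obtain ⟨x, rfl⟩ := h.2 a
    exact ⟨x, (h.1 x).symm.trans ha, rfl⟩

/-- A family of solutions that is jointly onto yields independent proper solutions. -/
lemma exists_independent {E : FiniteEmbeddingProblem F} (hE : E.IsNontrivial) {ι : Type u}
    (ψ : ι → F →ₜ* E.H) (hψ : ∀ i, E.IsSolution (ψ i))
    (h : JointlyOnto (E.φ : F →* E.G).ker E.α.ker (fun i => (ψ i : F → E.H))) :
    ∃ Ψ : Set (F →ₜ* E.H),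
      #Ψ = #ι ∧ (∀ ψ ∈ Ψ, E.IsProperSolution ψ) ∧ E.IndependentSolutions Ψ := by
  have hinj : Function.Injective ψ := fun i j hij => h.injective (ker_ne_bot hE) (by simp [hij])
  have hp : ∀ i, E.IsProperSolution (ψ i) := by
    refine fun i => ⟨hψ i, fun y => ?_⟩
    obtain ⟨x, hx⟩ := E.φ_surjective (E.α y)
    -- `ψ i x` differs from `y` by an element of Ker α, which is attained on Ker φ.
    obtain ⟨z, hz, hz'⟩ := h {i} (fun _ => y * (ψ i x)⁻¹)
      (fun _ => by simp [MonoidHom.mem_ker, hψ i x, hx])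
    exact ⟨z * x, by rw [map_mul, show ψ i z = _ from hz' i (by simp)]; simp⟩
  refine ⟨Set.range ψ, mk_range_eq ψ hinj, by rintro _ ⟨i, rfl⟩; exact hp i, ?_⟩
  have hR : ∀ χ : Set.range ψ, E.IsProperSolution (χ : F →ₜ* E.H) := by
    rintro ⟨_, ⟨i, rfl⟩⟩; exact hp i
  refine (independentSubgroups_iff_jointlyOnto
    (fun χ : Set.range ψ => ((χ : F →ₜ* E.H) : F →* E.H)) fun χ => (hR χ).map_ker).2 ?_
  have := h.comp (Equiv.ofInjective ψ hinj).symm.injective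
  have e : (fun χ : Set.range ψ => ((χ : F →ₜ* E.H) : F → E.H)) =
      (fun i => (ψ i : F → E.H)) ∘ (Equiv.ofInjective ψ hinj).symm := by
    ext χ x
    simp [Equiv.apply_ofInjective_symm]
  exact e ▸ this

end FiniteEmbeddingProblem

/-- In a semi-free group, a nontrivial finite split embedding problem has a jointly onto family
of solutions, indexed by a type whose cardinality is the rank. -/
lemma IsSemiFree.exists_jointlyOnto {F : Type u} [Group F] [TopologicalSpace F]
    [IsTopologicalGroup F] (hF : IsSemiFree F) (E : FiniteEmbeddingProblem F) (hs : E.IsSplit)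
    (hn : E.IsNontrivial) :
    ∃ (ι : Type u) (ψ : ι → F →ₜ* E.H), #ι = rank F ∧ (∀ i, E.IsProperSolution (ψ i)) ∧
      JointlyOnto (E.φ : F →* E.G).ker E.α.ker (fun i => (ψ i : F → E.H)) := by
  obtain ⟨Ψ, hc, hp, hi⟩ := hF.2 E hs hn
  exact ⟨Ψ, Subtype.val, hc, fun i => hp i i.2, (independentSubgroups_iff_jointlyOnto
    (fun χ : Ψ => ((χ : F →ₜ* E.H) : F →* E.H)) fun χ => (hp χ χ.2).map_ker).1 hi⟩

end SemiFree

/-! ### Open and closed subgroups of profinite groups. -/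

namespace SemiFree

/-- An open subgroup that contains a directed intersection of closed subgroups contains one of
them. -/
lemma exists_le_of_iInf_le {G ι : Type*} [Group G] [TopologicalSpace G] [CompactSpace G]
    [Nonempty ι] {N : ι → Subgroup G}
    (hd : Directed (· ≥ ·) N) (hc : ∀ i, IsClosed (N i : Set G)) {V : Subgroup G}
    (hV : IsOpen (V : Set G)) (h : ⨅ i, N i ≤ V) : ∃ i, N i ≤ V := by
  refine exists_subset_nhds_of_isCompact' (V := fun i => (N i : Set G)) hd
    (fun i => (hc i).isCompact) hc fun x hx => hV.mem_nhds (h ?_)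
  simpa [Subgroup.mem_iInf] using hx

section Profinite

variable {G : Type u} [Group G] [TopologicalSpace G] [IsTopologicalGroup G]

lemma finite_quotient_of_isOpen [CompactSpace G] {U : Subgroup G} (hU : IsOpen (U : Set G)) :
    Finite (G ⧸ U) :=
  Subgroup.quotient_finite_of_isOpen U hU

lemma finiteIndex_of_isOpen [CompactSpace G] {U : Subgroup G} (hU : IsOpen (U : Set G)) :
    U.FiniteIndex :=
  haveI := finite_quotient_of_isOpen hU
  Subgroup.finiteIndex_of_finite_quotient

variable [CompactSpace G] [TotallyDisconnectedSpace G]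

lemma exists_openNormal_subset {U : Set G} (hU : IsOpen U) (h1 : (1 : G) ∈ U) :
    ∃ V : Subgroup G, V.Normal ∧ IsOpen (V : Set G) ∧ (V : Set G) ⊆ U := by
  obtain ⟨V, hV⟩ := ProfiniteGrp.exist_openNormalSubgroup_sub_open_nhds_of_one hU h1
  exact ⟨V.toSubgroup, V.isNormal', V.isOpen', hV⟩

lemma exists_openNormal_notMem {x : G} (hx : x ≠ 1) :
    ∃ V : Subgroup G, V.Normal ∧ IsOpen (V : Set G) ∧ x ∉ V := by
  obtain ⟨V, h1, h2, h3⟩ := exists_openNormal_subset (isOpen_compl_singleton (x := x)) hx.symm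
  exact ⟨V, h1, h2, fun h => h3 h rfl⟩

/-- Membership in a closed subgroup can be tested on the open subgroups containing it. -/
lemma mem_of_forall_isOpen {M : Subgroup G} (hM : IsClosed (M : Set G)) {x : G}
    (h : ∀ V : Subgroup G, IsOpen (V : Set G) → M ≤ V → x ∈ V) : x ∈ M := by
  have := ProfiniteGrp.closedSubgroup_eq_sInf_open (⟨M, hM⟩ : ClosedSubgroup G)
  change x ∈ (⟨M, hM⟩ : ClosedSubgroup G).toSubgroup
  rw [this, Subgroup.mem_sInf]
  exact fun V hV => h V hV.1 hV.2

end Profinite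

/-! ### Generators converging to `1`, by Zorn's lemma. -/

section Generators

variable (G : Type u) [Group G] [TopologicalSpace G]

/-- The open normal subgroups of `G`. -/
abbrev OpenNormal : Type u := {U : Subgroup G // U.Normal ∧ IsOpen (U : Set G)}

/-- A partial system of generators of `G` converging to `1`: it generates `G` and converges to `1`
modulo the closed normal subgroup `N`. -/
structure PartialGenerators where
  N : Subgroup G
  f : (Σ U : OpenNormal G, G ⧸ U.1) → G
  normal : N.Normal
  closed : IsClosed (N : Set G)
  converges : ∀ U : Subgroup G, U.Normal → IsOpen (U : Set G) → N ≤ U → {t | f t ∉ U}.Finite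
  generates : ∀ V : Subgroup G, IsOpen (V : Set G) → N ≤ V → (∀ t, f t ∈ V) → V = ⊤
  support : ∀ t, f t ∉ N → N ≤ t.1.1

variable {G}

namespace PartialGenerators

/-- `q` refines `p`. -/
def Refines (p q : PartialGenerators G) : Prop :=
  q.N ≤ p.N ∧ ∀ t, (p.f t)⁻¹ * q.f t ∈ p.N

lemma Refines.trans {p q r : PartialGenerators G} (h : Refines p q) (h' : Refines q r) :
    Refines p r :=
  ⟨h'.1.trans h.1, fun t => by
    simpa [mul_assoc] using p.N.mul_mem (h.2 t) (h.1 (h'.2 t))⟩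

lemma Refines.refl (p : PartialGenerators G) : Refines p p := ⟨le_rfl, fun t => by simp⟩

variable [IsTopologicalGroup G] [CompactSpace G]

/-- The value at each index is a point common to a directed system of cosets, which exists by
compactness. An open subgroup containing the intersection of the `N` contains one of them, so every
condition descends to a member of the chain. -/
lemma exists_upperBound (c : Set (PartialGenerators G)) (hc : IsChain Refines c)
    (hne : c.Nonempty) : ∃ q, ∀ p ∈ c, Refines p q := by
  have hne' : Nonempty c := hne.to_subtype
  have hdir : ∀ p q : c, ∃ r : c, Refines p.1 r.1 ∧ Refines q.1 r.1 := by
    intro p q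
    rcases eq_or_ne p.1 q.1 with h | h
    · exact ⟨q, h ▸ Refines.refl _, Refines.refl _⟩
    · rcases hc p.2 q.2 h with h | h
      exacts [⟨q, h, Refines.refl _⟩, ⟨p, Refines.refl _, h⟩]
  have hd : Directed (· ≥ ·) (fun p : c => p.1.N) := fun p q =>
    let ⟨r, h1, h2⟩ := hdir p q
    ⟨r, h1.1, h2.1⟩
  have hf : ∀ t, ∃ x : G, ∀ p : c, (p.1.f t)⁻¹ * x ∈ p.1.N := by
    intro t
    have := IsCompact.nonempty_iInter_of_directed_nonempty_isCompact_isClosed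
      (fun p : c => {x : G | (p.1.f t)⁻¹ * x ∈ p.1.N}) ?_ ?_ ?_ ?_
    · obtain ⟨x, hx⟩ := this
      exact ⟨x, fun p => Set.mem_iInter.1 hx p⟩
    · intro p q
      obtain ⟨r, h1, h2⟩ := hdir p q
      refine ⟨r, fun x hx => ?_, fun x hx => ?_⟩
      · simpa [mul_assoc] using p.1.N.mul_mem (h1.2 t) (h1.1 hx)
      · simpa [mul_assoc] using q.1.N.mul_mem (h2.2 t) (h2.1 hx)
    · exact fun p => ⟨p.1.f t, by simp⟩
    · exact fun p => (p.1.closed.preimage (continuous_const_mul _)).isCompact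
    · exact fun p => p.1.closed.preimage (continuous_const_mul _)
  choose f hf using hf
  have hex : ∀ V : Subgroup G, IsOpen (V : Set G) → ⨅ p : c, p.1.N ≤ V → ∃ p : c, p.1.N ≤ V :=
    fun V hV h => exists_le_of_iInf_le hd (fun p => p.1.closed) hV h
  refine ⟨⟨⨅ p : c, p.1.N, f, ?_, ?_, ?_, ?_, ?_⟩, fun p hp =>
    ⟨iInf_le (fun p : c => p.1.N) ⟨p, hp⟩, fun t => hf t ⟨p, hp⟩⟩⟩
  · exact Subgroup.normal_iInf_normal fun p => p.1.normal
  · rw [Subgroup.coe_iInf]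
    exact isClosed_iInter fun p => p.1.closed
  · intro U hn hU h
    obtain ⟨p, hp⟩ := hex U hU h
    refine (p.1.converges U hn hU hp).subset fun t ht h' => ht ?_
    simpa using U.mul_mem h' (hp (hf t p))
  · intro V hV h h'
    obtain ⟨p, hp⟩ := hex V hV h
    refine p.1.generates V hV hp fun t => ?_
    simpa using V.mul_mem (h' t) (V.inv_mem (hp (hf t p)))
  · intro t ht
    rw [Subgroup.mem_iInf, not_forall] at ht
    obtain ⟨p, hp⟩ := ht
    refine (iInf_le (fun p : c => p.1.N) p).trans (p.1.support t fun h => hp ?_)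
    simpa using p.1.N.mul_mem h (hf t p)

/-- Passing from `N` to `N ⊓ U` needs new generators only for the finite group `NU/U`. They occupy
the block of indices belonging to `U`, which `support` has kept trivial modulo `N` because `N` is
not inside `U`. Every other value is moved within its `N`-coset into `U` whenever possible, which
preserves convergence. -/
lemma exists_refinement (p : PartialGenerators G) {U : Subgroup G} (hn : U.Normal)
    (hU : IsOpen (U : Set G)) (hp : ¬ p.N ≤ U) : ∃ q, Refines p q ∧ q.N ≤ U := by
  classical
  have := p.normal
  have h1 : ∀ t, ∃ y, (p.f t)⁻¹ * y ∈ p.N ∧ (p.f t ∈ p.N ⊔ U → y ∈ U) := by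
    intro t
    by_cases h : p.f t ∈ p.N ⊔ U
    · rw [sup_comm] at h
      obtain ⟨u, hu, n, hn', e⟩ := Subgroup.mem_sup_of_normal_left.1 h
      exact ⟨u, by simpa [← e] using hn', fun _ => hu⟩
    · exact ⟨p.f t, by simp, fun h' => (h h').elim⟩
  choose g hg hgU using h1
  have h2 : ∀ z : G ⧸ U, ∃ n ∈ p.N, (∃ n' ∈ p.N, (n' : G ⧸ U) = z) → (n : G ⧸ U) = z := by
    intro z
    by_cases h : ∃ n' ∈ p.N, (n' : G ⧸ U) = z
    · obtain ⟨n, hn, e⟩ := h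
      exact ⟨n, hn, fun _ => e⟩
    · exact ⟨1, p.N.one_mem, fun h' => (h h').elim⟩
  choose r hrN hr using h2
  let f' : (Σ U : OpenNormal G, G ⧸ U.1) → G := fun t =>
    if h : t.1.1 = U then r (h ▸ t.2) else g t
  have hf1 : ∀ z : G ⧸ U, f' ⟨⟨U, hn, hU⟩, z⟩ = r z := fun z => by simp [f']
  have hf2 : ∀ t, t.1.1 ≠ U → f' t = g t := fun t h => by simp [f', h]
  have hN1 : ∀ t, t.1.1 = U → p.f t ∈ p.N ∧ f' t ∈ p.N := by
    rintro ⟨⟨V, hV⟩, z⟩ (rfl : V = U)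
    refine ⟨by_contra fun h => hp (p.support _ h), ?_⟩
    rw [hf1]
    exact hrN z
  have href : ∀ t, (p.f t)⁻¹ * f' t ∈ p.N := by
    intro t
    by_cases h : t.1.1 = U
    · exact p.N.mul_mem (p.N.inv_mem (hN1 t h).1) (hN1 t h).2
    · rw [hf2 t h]; exact hg t
  refine ⟨⟨p.N ⊓ U, f', inferInstance, p.closed.inter (U.isClosed_of_isOpen hU),
    ?_, ?_, ?_⟩, ⟨inf_le_left, href⟩, inf_le_right⟩
  · intro V hVn hV hle
    have hfin : {t : Σ U : OpenNormal G, G ⧸ U.1 | t.1.1 = U}.Finite := by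
      have : Finite (G ⧸ U) := finite_quotient_of_isOpen hU
      refine (Set.finite_range fun z : G ⧸ U =>
        (⟨⟨U, hn, hU⟩, z⟩ : Σ U : OpenNormal G, G ⧸ U.1)).subset ?_
      rintro ⟨⟨V, hV⟩, z⟩ (rfl : V = U)
      exact ⟨z, rfl⟩
    have hopen : IsOpen ((p.N ⊔ (V ⊓ U) : Subgroup G) : Set G) :=
      Subgroup.isOpen_mono le_sup_right (hV.inter hU)
    refine (hfin.union (p.converges (p.N ⊔ (V ⊓ U)) inferInstance hopen le_sup_left)).subset ?_
    intro t ht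
    by_contra hcon
    simp only [Set.mem_union, Set.mem_ofPred_eq, not_or, not_not] at hcon ht
    obtain ⟨h1, h2⟩ := hcon
    rw [hf2 t h1] at ht
    have h3 : g t ∈ U := hgU t ((sup_le_sup le_rfl inf_le_right : p.N ⊔ (V ⊓ U) ≤ p.N ⊔ U) h2)
    have h4 : g t ∈ p.N ⊔ (V ⊓ U) := by
      simpa using Subgroup.mul_mem _ h2 (le_sup_left (a := p.N) (b := V ⊓ U) (hg t))
    -- As `g t` and `v` lie in `U`, so does `n`; thus `n` is in `N ⊓ U`, hence in `V`.
    obtain ⟨n, hn', v, hv, e⟩ := Subgroup.mem_sup_of_normal_left.1 h4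
    have hnU : n ∈ U := by
      have : n = g t * v⁻¹ := by rw [← e]; group
      rw [this]
      exact U.mul_mem h3 (U.inv_mem hv.2)
    exact ht (e ▸ V.mul_mem (hle ⟨hn', hnU⟩) hv.1)
  · intro V hV hle hfV
    have hNV : p.N ≤ V := by
      intro n hnN
      have h1 := hfV ⟨⟨U, hn, hU⟩, (n : G ⧸ U)⟩
      rw [hf1] at h1
      have h2 : (r (n : G ⧸ U))⁻¹ * n ∈ U := QuotientGroup.eq.1 (hr n ⟨n, hnN, rfl⟩)
      simpa using V.mul_mem h1 (hle ⟨p.N.mul_mem (p.N.inv_mem (hrN n)) hnN, h2⟩)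
    refine p.generates V hV hNV fun t => ?_
    simpa using V.mul_mem (hfV t) (V.inv_mem (hNV (href t)))
  · intro t ht
    by_cases h : t.1.1 = U
    · rw [h]; exact inf_le_right
    · by_cases h' : p.f t ∈ p.N
      · refine (ht ⟨by simpa using p.N.mul_mem h' (href t), ?_⟩).elim
        rw [hf2 t h]
        exact hgU t (le_sup_left (a := p.N) h')
      · exact inf_le_left.trans (p.support t h')

end PartialGenerators

variable [IsTopologicalGroup G] [CompactSpace G] [TotallyDisconnectedSpace G]

lemma topologicallyGenerates_of_forall {X : Set G}
    (h : ∀ V : Subgroup G, IsOpen (V : Set G) → X ⊆ V → V = ⊤) : TopologicallyGenerates X := by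
  refine eq_top_iff.2 fun x _ => mem_of_forall_isOpen (Subgroup.isClosed_topologicalClosure _)
    fun V hV hle => ?_
  rw [h V hV ((Subgroup.subset_closure.trans (Subgroup.le_topologicalClosure _)).trans hle)]
  trivial

variable (G) in
/-- Each profinite group has a set of generators converging to `1`. -/
lemma exists_generators_convergesToOne :
    ∃ X : Set G, TopologicallyGenerates X ∧ ConvergesToOne X ∧ #X ≤ max ℵ₀ #(OpenNormal G) := by
  obtain ⟨p, hp⟩ := exists_maximal_of_chains_bounded (r := PartialGenerators.Refines (G := G))
    (fun c hc => by
      rcases c.eq_empty_or_nonempty with rfl | hne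
      · exact ⟨⟨⊤, fun _ => 1, inferInstance, by simp, by simp, by simp, by simp⟩, by simp⟩
      · exact PartialGenerators.exists_upperBound c hc hne)
    PartialGenerators.Refines.trans
  have hN : ∀ U : Subgroup G, U.Normal → IsOpen (U : Set G) → p.N ≤ U := by
    intro U hn hU
    by_contra h
    obtain ⟨q, hq, hqU⟩ := p.exists_refinement hn hU h
    exact h ((hp q hq).1.trans hqU)
  have hbot : p.N = ⊥ := by
    refine (Subgroup.eq_bot_iff_forall _).2 fun x hx => by_contra fun h1 => ?_
    obtain ⟨V, h2, h3, h4⟩ := exists_openNormal_notMem h1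
    exact h4 (hN V h2 h3 hx)
  refine ⟨Set.range p.f, topologicallyGenerates_of_forall fun V hV h =>
    p.generates V hV (by simp [hbot]) fun t => h ⟨t, rfl⟩, fun U hn hU => ?_, ?_⟩
  · refine ((p.converges U hn hU (hN U hn hU)).image p.f).subset ?_
    rintro _ ⟨⟨t, rfl⟩, ht⟩
    exact ⟨t, ht, rfl⟩
  · refine mk_range_le.trans ?_
    rw [mk_sigma]
    refine (sum_le_mk_mul_iSup _).trans ?_
    refine (mul_le_max _ _).trans ?_
    refine max_le (max_le (le_max_right _ _) ?_) (le_max_left _ _)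
    refine (ciSup_le' fun U => ?_).trans (le_max_left _ _)
    have := finite_quotient_of_isOpen U.2.2
    exact (lt_aleph0_of_finite _).le

end Generators

/-! ### Counting homomorphisms and open normal subgroups. -/

section Homs

variable {G : Type u} [Group G] [TopologicalSpace G] [IsTopologicalGroup G]

/-- The homomorphisms to `H` with open kernel. -/
abbrev OpenHom (G H : Type*) [Group G] [TopologicalSpace G] [Group H] : Type _ :=
  {χ : G →* H // IsOpen (χ.ker : Set G)}

lemma isOpen_eqLocus {H : Type*} [Group H] (χ χ' : OpenHom G H) :
    IsOpen (χ.1.eqLocus χ'.1 : Set G) :=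
  Subgroup.isOpen_mono (H₁ := χ.1.ker ⊓ χ'.1.ker)
    (fun x hx => (show χ.1 x = 1 from hx.1).trans (show χ'.1 x = 1 from hx.2).symm)
    (χ.2.inter χ'.2)

lemma eq_of_eqOn_generators {H : Type*} [Group H] {X : Set G} (hX : TopologicallyGenerates X)
    {χ χ' : OpenHom G H} (h : ∀ x ∈ X, χ.1 x = χ'.1 x) : χ = χ' := by
  have h1 : (⊤ : Subgroup G) ≤ χ.1.eqLocus χ'.1 := by
    rw [← show _ = ⊤ from hX]
    exact Subgroup.topologicalClosure_minimal _ ((Subgroup.closure_le _).2 h)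
      (Subgroup.isClosed_of_isOpen _ (isOpen_eqLocus χ χ'))
  exact Subtype.ext (MonoidHom.ext fun x => h1 (Subgroup.mem_top x))

/-- Convergence to `1` leaves finitely many generators with nontrivial image; the graph on these
determines the homomorphism. -/
lemma mk_openHom_le {H : Type u} [Group H] {X : Set G} (hX : TopologicallyGenerates X)
    (hc : ConvergesToOne X) : #(OpenHom G H) ≤ #(Finset (X × H)) := by
  classical
  have hfin : ∀ χ : OpenHom G H, {x : X | χ.1 x ≠ 1}.Finite := fun χ =>
    Set.Finite.of_finite_image ((hc χ.1.ker inferInstance χ.2).subset (by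
      rintro _ ⟨x, hx, rfl⟩; exact ⟨x.2, hx⟩)) Subtype.val_injective.injOn
  let code : OpenHom G H → Finset (X × H) := fun χ => (hfin χ).toFinset.image fun x => (x, χ.1 x)
  have hcode : ∀ χ (x : X) (y : H), y ≠ 1 → ((x, y) ∈ code χ ↔ χ.1 x = y) := by
    intro χ x y hy
    simp only [code, Finset.mem_image, Set.Finite.mem_toFinset, Set.mem_ofPred_eq, Prod.mk.injEq]
    constructor
    · rintro ⟨x', -, rfl, rfl⟩; rfl
    · rintro rfl; exact ⟨x, hy, rfl, rfl⟩
  refine mk_le_of_injective (f := code) fun χ χ' h => eq_of_eqOn_generators hX fun x hx => ?_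
  by_cases h1 : χ.1 x = 1
  · by_contra h2
    have h3 : χ'.1 x ≠ 1 := fun h3 => h2 (h1.trans h3.symm)
    exact h2 ((hcode χ ⟨x, hx⟩ _ h3).1 (h ▸ (hcode χ' ⟨x, hx⟩ _ h3).2 rfl))
  · exact ((hcode χ' ⟨x, hx⟩ _ h1).1 (h ▸ (hcode χ ⟨x, hx⟩ _ h1).2 rfl)).symm

lemma mk_finset_le_max (α : Type u) : #(Finset α) ≤ max ℵ₀ #α := by
  rcases finite_or_infinite α with h | h
  · exact (lt_aleph0_of_finite _).le.trans (le_max_left _ _)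
  · rw [mk_finset_of_infinite]; exact le_max_right _ _

lemma mk_openHom_le_max {H : Type u} [Group H] [Finite H] {X : Set G}
    (hX : TopologicallyGenerates X) (hc : ConvergesToOne X) :
    #(OpenHom G H) ≤ max ℵ₀ #X := by
  refine ((mk_openHom_le hX hc).trans (mk_finset_le_max _)).trans (max_le (le_max_left _ _) ?_)
  rw [mk_prod, lift_id, lift_id]
  refine (mul_le_max _ _).trans (max_le (max_le (le_max_right _ _) ?_) (le_max_left _ _))
  exact (lt_aleph0_of_finite _).le.trans (le_max_left _ _)

/-- An open normal subgroup is the kernel of the translation action on its finite quotient, hence of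
a homomorphism to one of countably many symmetric groups. -/
lemma mk_openNormal_le_max [CompactSpace G] {X : Set G} (hX : TopologicallyGenerates X)
    (hc : ConvergesToOne X) : #(OpenNormal G) ≤ max ℵ₀ #X := by
  classical
  let P : ℕ → Type u := fun n => Equiv.Perm (ULift.{u} (Fin n))
  have h : ∀ U : OpenNormal G, ∃ s : Σ n, OpenHom G (P n), s.2.1.ker = U.1 := by
    rintro ⟨U, hn, hU⟩
    have := finite_quotient_of_isOpen hU
    obtain ⟨n, ⟨e⟩⟩ := Finite.exists_equiv_fin (G ⧸ U)
    let e' : G ⧸ U ≃ ULift.{u} (Fin n) := e.trans Equiv.ulift.symm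
    let χ : G →* P n := e'.permCongrHom.toMonoidHom.comp (MulAction.toPermHom G (G ⧸ U))
    have hχ : χ.ker = U := by
      have h1 : (MulAction.toPermHom G (G ⧸ U)).ker = U := by
        rw [← Subgroup.normalCore_eq_ker, Subgroup.normalCore_eq_self]
      rw [← h1]
      ext x
      simp [χ, MonoidHom.mem_ker]
    exact ⟨⟨n, χ, by rw [hχ]; exact hU⟩, hχ⟩
  choose s hs using h
  have hinj : Function.Injective s := fun U V h => Subtype.ext (by rw [← hs, ← hs, h])
  refine (mk_le_of_injective hinj).trans ?_
  rw [mk_sigma]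
  refine (sum_le_lift_mk_mul_iSup _).trans ?_
  refine (mul_le_max _ _).trans (max_le (max_le (by simp) ?_) (le_max_left _ _))
  exact ciSup_le' fun n => mk_openHom_le_max hX hc

lemma exists_generators_mk_eq_rank (h : ℵ₀ ≤ rank G) :
    ∃ X : Set G, TopologicallyGenerates X ∧ ConvergesToOne X ∧ #X = rank G := by
  have hne : {c | ∃ X : Set G, TopologicallyGenerates X ∧ ConvergesToOne X ∧ #X = c}.Nonempty := by
    by_contra hne
    rw [Set.not_nonempty_iff_eq_empty] at hne
    rw [rank, hne, Cardinal.sInf_empty] at h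
    exact absurd h (not_le.2 aleph0_pos)
  exact csInf_mem hne

lemma mk_openNormal_le_rank [CompactSpace G] (h : ℵ₀ ≤ rank G) :
    #(OpenNormal G) ≤ rank G := by
  obtain ⟨X, hX, hc, e⟩ := exists_generators_mk_eq_rank h
  exact e ▸ (mk_openNormal_le_max hX hc).trans (max_le (e ▸ h) le_rfl)

/-- For each open subgroup `V` of `M` there is an open normal subgroup of `G` meeting `M` inside
`V`. -/
lemma exists_openNormal_subgroupOf_le [CompactSpace G] [TotallyDisconnectedSpace G]
    {M : Subgroup G} {V : Subgroup M} (hV : IsOpen (V : Set M)) :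
    ∃ U : Subgroup G, U.Normal ∧ IsOpen (U : Set G) ∧ ∀ x : M, (x : G) ∈ U → x ∈ V := by
  obtain ⟨O, hO, e⟩ := isOpen_induced_iff.1 hV
  obtain ⟨U, hn, hU, hle⟩ := exists_openNormal_subset hO (by
    have : (1 : M) ∈ ((↑) ⁻¹' O : Set M) := e ▸ V.one_mem
    exact this)
  refine ⟨U, hn, hU, fun x hx => ?_⟩
  have : x ∈ ((↑) ⁻¹' O : Set M) := hle hx
  rw [e] at this
  exact this

lemma mk_openNormal_subgroup_le [CompactSpace G] [TotallyDisconnectedSpace G] (M : Subgroup G) :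
    #(OpenNormal M) ≤ max ℵ₀ #(OpenNormal G) := by
  have h : ∀ V : OpenNormal M, ∃ U : OpenNormal G, ∀ x : M, (x : G) ∈ U.1 → x ∈ V.1 := fun V =>
    let ⟨U, hn, hU, hle⟩ := exists_openNormal_subgroupOf_le V.2.2
    ⟨⟨U, hn, hU⟩, hle⟩
  choose u hu using h
  -- `V` contains `M ∩ u V`, so its image modulo `u V` determines it.
  let s : OpenNormal M → Σ U : OpenNormal G, Set (G ⧸ U.1) := fun V =>
    ⟨u V, (fun x : M => ((x : G) : G ⧸ (u V).1)) '' (V.1 : Set M)⟩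
  have hs : ∀ V (x : M), ((x : G) : G ⧸ (s V).1.1) ∈ (s V).2 ↔ x ∈ V.1 := by
    intro V x
    constructor
    · rintro ⟨y, hy, e⟩
      have h1 : (y : G)⁻¹ * x ∈ (u V).1 := QuotientGroup.eq.1 e
      simpa using V.1.mul_mem hy (hu V (y⁻¹ * x) h1)
    · exact fun hx => ⟨x, hx, rfl⟩
  have hinj : Function.Injective s := fun V V' h => Subtype.ext (by
    ext x; rw [← hs, ← hs, h])
  refine (mk_le_of_injective hinj).trans ?_
  rw [mk_sigma]
  refine (sum_le_mk_mul_iSup _).trans ((mul_le_max _ _).trans ?_)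
  refine max_le (max_le (le_max_right _ _) ?_) (le_max_left _ _)
  refine (ciSup_le' fun U => ?_).trans (le_max_left _ _)
  have := finite_quotient_of_isOpen U.2.2
  exact (lt_aleph0_of_finite _).le

end Homs

/-- A closed subgroup `M` of a group of infinite rank `m` is semi-free of rank `m` if each
nontrivial finite split embedding problem for `M` has a jointly onto family of `m` solutions. -/
lemma isSemiFree_of_forall_exists_jointlyOnto {F : Type u} [Group F] [TopologicalSpace F]
    [IsTopologicalGroup F] [CompactSpace F] [TotallyDisconnectedSpace F] {m : Cardinal.{u}}
    (hm : ℵ₀ ≤ m) (hF : rank F = m) {M : Subgroup F} (hM : IsClosed (M : Set F))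
    (h : ∀ E : FiniteEmbeddingProblem M, E.IsSplit → E.IsNontrivial →
      ∃ (ι : Type u) (ψ : ι → M →ₜ* E.H), #ι = m ∧ (∀ i, E.IsSolution (ψ i)) ∧
        JointlyOnto (E.φ : M →* E.G).ker E.α.ker (fun i => (ψ i : M → E.H))) :
    IsSemiFree M ∧ rank M = m := by
  have : CompactSpace M := isCompact_iff_compactSpace.1 hM.isCompact
  have hopen : #(OpenNormal M) ≤ m := (mk_openNormal_subgroup_le M).trans
    (max_le hm (hF ▸ mk_openNormal_le_rank (hF.symm ▸ hm)))
  have hlow : ∀ X : Set M, TopologicallyGenerates X → ConvergesToOne X → m ≤ #X := by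
    intro X hX hc
    -- The problem with trivial `G` and `H` of order two already produces `m` different
    -- homomorphisms, which bounds the size of a generating set from below.
    let C : Type u := ULift (Multiplicative (ZMod 2))
    let _ : TopologicalSpace C := ⊥
    have : DiscreteTopology C := ⟨rfl⟩
    let E : FiniteEmbeddingProblem M :=
      { G := PUnit
        H := C
        φ := 1
        α := 1
        φ_surjective := fun _ => ⟨1, rfl⟩
        α_surjective := fun _ => ⟨1, rfl⟩ }
    have hE : E.IsNontrivial := fun hb =>
      absurd (congrArg ULift.down
        (hb.1 (a₁ := (⟨.ofAdd 0⟩ : C)) (a₂ := (⟨.ofAdd 1⟩ : C)) rfl)) (by decide)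
    obtain ⟨ι, ψ, hι, -, hψ⟩ := h E ⟨1, fun _ => rfl⟩ hE
    let χ : ι → OpenHom M C := fun i => ⟨(ψ i : M →* C),
      (isOpen_discrete ({1} : Set C)).preimage (ψ i).continuous_toFun⟩
    have hχ : Function.Injective χ := fun i j hij =>
      hψ.injective (FiniteEmbeddingProblem.ker_ne_bot hE)
        (congrArg (fun χ : OpenHom M C => (χ.1 : M → C)) hij)
    have hle : m ≤ #(OpenHom M C) := hι ▸ mk_le_of_injective hχ
    rcases finite_or_infinite X with hfin | hinf
    · have : Finite C := E.finiteH
      exact absurd (hm.trans (hle.trans (mk_openHom_le hX hc)))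
        (not_le.2 (lt_aleph0_of_finite _))
    · have : Finite C := E.finiteH
      exact (hle.trans (mk_openHom_le_max hX hc)).trans (max_le (aleph0_le_mk X) le_rfl)
  have hrank : rank M = m := by
    obtain ⟨X, hX, hc, hle⟩ := exists_generators_convergesToOne M
    have hle' : rank M ≤ #X := csInf_le' ⟨X, hX, hc, rfl⟩
    refine le_antisymm (hle'.trans (hle.trans (max_le hm hopen))) (le_csInf ⟨#X, X, hX, hc, rfl⟩ ?_)
    rintro _ ⟨Y, hY, hYc, rfl⟩
    exact hlow Y hY hYc
  refine ⟨⟨hrank ▸ hm, fun E hs hn => ?_⟩, hrank⟩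
  obtain ⟨ι, ψ, hι, hsol, hψ⟩ := h E hs hn
  obtain ⟨Ψ, h1, h2⟩ := FiniteEmbeddingProblem.exists_independent hn ψ hsol hψ
  exact ⟨Ψ, h1.trans (hι.trans hrank.symm), h2⟩

end SemiFree

/-! ### Twisted wreath products and induced solutions. -/

namespace SemiFree

namespace TwistedWreath

variable {Q A : Type*} [Group Q] [Group A] {G₀ : Subgroup Q} (η : G₀ →* MulAut A)

/-- The induced group of the `G₀`-group `A`. -/
def Ind : Subgroup (Q → A) where
  carrier := {f | ∀ σ (ρ : G₀), f (σ * ρ) = η ρ⁻¹ (f σ)}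
  mul_mem' hf hg σ ρ := by simp [hf σ ρ, hg σ ρ]
  one_mem' σ ρ := by simp
  inv_mem' hf σ ρ := by simp [hf σ ρ]

/-- The action of `Q` on the induced group by translation. -/
def act : Q →* MulAut (Ind η) where
  toFun τ :=
    { toFun := fun f => ⟨fun σ => f.1 (τ⁻¹ * σ), fun σ ρ => by
        have h := f.2 (τ⁻¹ * σ) ρ
        rwa [mul_assoc] at h⟩
      invFun := fun f => ⟨fun σ => f.1 (τ * σ), fun σ ρ => by
        have h := f.2 (τ * σ) ρ
        rwa [mul_assoc] at h⟩
      left_inv := fun f => by ext σ; simp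
      right_inv := fun f => by ext σ; simp
      map_mul' := fun f g => rfl }
  map_one' := by ext f σ; simp
  map_mul' τ τ' := by ext f σ; simp [mul_assoc]

@[simp] lemma act_apply (τ : Q) (f : Ind η) (σ : Q) : (act η τ f).1 σ = f.1 (τ⁻¹ * σ) := rfl

/-- The twisted wreath product. -/
abbrev Wreath : Type _ := Ind η ⋊[act η] Q

instance [Finite Q] [Finite A] : Finite (Wreath η) :=
  Finite.of_equiv _ SemidirectProduct.equivProd.symm

open Classical in
/-- The element of the induced group that is supported on `G₀` and has the value `a` at `1`. -/
noncomputable def single (a : A) : Ind η :=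
  ⟨fun σ => if h : σ ∈ G₀ then η ⟨σ, h⟩⁻¹ a else 1, fun σ ρ => by
    by_cases h : σ ∈ G₀
    · have h' : σ * ρ ∈ G₀ := G₀.mul_mem h ρ.2
      have e : (⟨σ * ρ, h'⟩ : G₀) = ⟨σ, h⟩ * ρ := rfl
      simp only [dif_pos h, dif_pos h', e, mul_inv_rev, map_mul, MulAut.mul_apply]
    · have h' : σ * ρ ∉ G₀ := fun h' => h ((G₀.mul_mem_cancel_right ρ.2).1 h')
      simp only [dif_neg h, dif_neg h', map_one]⟩

lemma single_one (a : A) : (single η a).1 1 = a := by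
  have e : (⟨1, G₀.one_mem⟩ : G₀) = 1 := rfl
  simp only [single, dif_pos G₀.one_mem, e, inv_one, map_one, MulAut.one_apply]

lemma single_of_notMem (a : A) {σ : Q} (h : σ ∉ G₀) : (single η a).1 σ = 1 := dif_neg h

lemma left_conj (w v : Wreath η) (hv : v.right = 1) (τ : Q) :
    (w * v * w⁻¹).left.1 τ = w.left.1 τ * v.left.1 (w.right⁻¹ * τ) * (w.left.1 τ)⁻¹ := by
  simp [hv]

/-- Conjugation by `w` translates the argument by `w.right⁻¹` and conjugates the value, so the
second factor is trivial at `τ` as soon as `v` is trivial at the translated point. -/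
lemma left_mul_conj_inv (w v : Wreath η) (hv : v.right = 1) {τ : Q}
    (h : v.left.1 (w.right⁻¹ * τ) = 1) :
    (v * (w * v⁻¹ * w⁻¹)).left.1 τ = v.left.1 τ := by
  have h1 : (v * (w * v⁻¹ * w⁻¹)).left.1 τ = v.left.1 τ * (w * v⁻¹ * w⁻¹).left.1 τ := by
    simp [hv]
  rw [h1, left_conj _ _ _ (by simp [hv])]
  simp [hv, h]

end TwistedWreath

open TwistedWreath

section

variable {F : Type u} [Group F] [TopologicalSpace F] [IsTopologicalGroup F]

lemma IsSemiFree.exists_family {G H : Type u} [Group G] [Group H] [Finite G] [Finite H]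
    (hF : IsSemiFree F) (φ : F →* G) (hφ : IsOpen (φ.ker : Set F)) (α : H →* G) (β : G →* H)
    (hφs : Function.Surjective φ) (hαβ : ∀ g, α (β g) = g) (hα : α.ker ≠ ⊥) :
    ∃ (ι : Type u) (ψ : ι → F →* H), #ι = rank F ∧ (∀ i, IsOpen ((ψ i).ker : Set F)) ∧
      (∀ i x, α (ψ i x) = φ x) ∧ (∀ i, Function.Surjective (ψ i)) ∧
      JointlyOnto φ.ker α.ker (fun i => (ψ i : F → H)) := by
  let _ : TopologicalSpace G := ⊥
  let _ : TopologicalSpace H := ⊥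
  have : DiscreteTopology G := ⟨rfl⟩
  have : DiscreteTopology H := ⟨rfl⟩
  have hc : Continuous φ := continuous_of_continuousAt_one φ (by
    rw [ContinuousAt, map_one, nhds_discrete G, Filter.tendsto_pure]
    exact hφ.mem_nhds φ.ker.one_mem)
  let E : FiniteEmbeddingProblem F :=
    { G := G
      H := H
      φ := ⟨φ, hc⟩
      α := α
      φ_surjective := hφs
      α_surjective := fun g => ⟨β g, hαβ g⟩ }
  obtain ⟨ι, ψ, h1, h2, h3⟩ := hF.exists_jointlyOnto E ⟨β, hαβ⟩ fun h =>
    hα ((MonoidHom.ker_eq_bot_iff _).2 h.1)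
  exact ⟨ι, fun i => (ψ i : F →* H), h1, fun i =>
    (isOpen_discrete ({1} : Set H)).preimage (ψ i).continuous_toFun, fun i => (h2 i).1,
    fun i => (h2 i).2, h3⟩

lemma exists_factor_subgroupMap {F G : Type*} [Group F] [Group G] {M : Subgroup F} (φ : M →* G)
    (L : Subgroup F) [L.Normal] (hL : ∀ x : M, (x : F) ∈ L → φ x = 1) :
    ∃ θ : M.map (QuotientGroup.mk' L) →* G,
      ∀ x, θ ((QuotientGroup.mk' L).subgroupMap M x) = φ x := by
  set q := (QuotientGroup.mk' L).subgroupMap M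
  have hk : q.ker ≤ φ.ker := fun x hx =>
    hL x ((QuotientGroup.eq_one_iff _).1 (congrArg Subtype.val hx))
  exact ⟨q.liftOfSurjective ((QuotientGroup.mk' L).subgroupMap_surjective M) ⟨_, hk⟩,
    fun x => q.liftOfRightInverse_comp_apply _ _ ⟨_, hk⟩ x⟩

/-- The semi-free group `F` has a jointly onto family of homomorphisms to a twisted wreath
product built from a split embedding problem for a subgroup `M`, each of which induces a
solution of that problem. -/
lemma IsSemiFree.exists_wreath_family (hF : IsSemiFree F) [CompactSpace F] {M : Subgroup F}
    (E : FiniteEmbeddingProblem M) (hs : E.IsSplit) (hn : E.IsNontrivial) {L : Subgroup F}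
    [L.Normal] (hLo : IsOpen (L : Set F)) (hL : ∀ x : M, (x : F) ∈ L → E.φ x = 1) :
    ∃ (η : M.map (QuotientGroup.mk' L) →* MulAut E.α.ker) (ι : Type u) (ψ : ι → F →* Wreath η),
      #ι = rank F ∧ (∀ i, IsOpen ((ψ i).ker : Set F)) ∧ (∀ i x, (ψ i x).right = (x : F ⧸ L)) ∧
      (∀ i, Function.Surjective (ψ i)) ∧
      JointlyOnto L SemidirectProduct.rightHom.ker (fun i => (ψ i : F → Wreath η)) ∧
      ∀ i, ∃ χ : M →ₜ* E.H, E.IsSolution χ ∧ ∀ x : M, (x : F) ∈ L → χ x = (ψ i x).left.1 1 := by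
  obtain ⟨β, hβ⟩ := hs
  have := finite_quotient_of_isOpen hLo
  let q : M →* M.map (QuotientGroup.mk' L) := (QuotientGroup.mk' L).subgroupMap M
  obtain ⟨θ, hθ⟩ := exists_factor_subgroupMap (E.φ : M →* E.G) L hL
  let η : M.map (QuotientGroup.mk' L) →* MulAut E.α.ker := MulAut.conjNormal.comp (β.comp θ)
  have hker : (SemidirectProduct.rightHom : Wreath η →* F ⧸ L).ker ≠ ⊥ := by
    obtain ⟨a, ha, ha1⟩ := E.α.ker.bot_or_exists_ne_one.resolve_left
      (FiniteEmbeddingProblem.ker_ne_bot hn)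
    intro h
    have h1 : (SemidirectProduct.inl (single η ⟨a, ha⟩) : Wreath η) ∈ (⊥ : Subgroup _) := by
      rw [← h]; simp [MonoidHom.mem_ker]
    rw [Subgroup.mem_bot] at h1
    have h2 := congrArg (fun w : Wreath η => (w.left.1 1 : E.H)) h1
    simp only [SemidirectProduct.left_inl, single_one] at h2
    exact ha1 h2
  obtain ⟨ι, ψ, h1, h2, h3, h4, h5⟩ := hF.exists_family (QuotientGroup.mk' L)
    (by rw [QuotientGroup.ker_mk']; exact hLo)
    (SemidirectProduct.rightHom : Wreath η →* F ⧸ L) SemidirectProduct.inr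
    (QuotientGroup.mk'_surjective L) (fun g => SemidirectProduct.rightHom_inr g) hker
  rw [QuotientGroup.ker_mk'] at h5
  refine ⟨η, ι, ψ, h1, h2, h3, h4, h5, fun i => ?_⟩
  -- Evaluation at `1` is a crossed homomorphism on `M`: for `x` in `M`, equivariance turns the
  -- translate `f (x⁻¹)` into the action of `x` on `f 1`. Multiplying by `β ∘ φ` makes it a
  -- homomorphism.
  have hleft : ∀ x y : M, (ψ i (x * y)).left.1 1 =
      (ψ i x).left.1 1 * MulAut.conjNormal (β (E.φ x)) ((ψ i y).left.1 1) := by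
    intro x y
    have hr : (ψ i x).right = (q x).1 := h3 i x
    rw [map_mul, SemidirectProduct.mul_left, Subgroup.coe_mul, Pi.mul_apply, act_apply, hr, mul_one]
    have h6 := (ψ i y).left.2 1 (q x)⁻¹
    rw [one_mul, inv_inv] at h6
    have h7 : E.φ x = θ (q x) := (hθ x).symm
    rw [h7]
    exact congrArg _ h6
  let χ : M →* E.H :=
    { toFun := fun x => ((ψ i x).left.1 1 : E.H) * β (E.φ x)
      map_one' := by simp
      map_mul' := fun x y => by
        rw [Subgroup.coe_mul M, hleft]
        simp [mul_assoc] }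
  have hχ : Continuous χ := by
    refine continuous_of_continuousAt_one χ ?_
    rw [ContinuousAt, map_one, nhds_discrete E.H, Filter.tendsto_pure]
    have e1 : ∀ᶠ x : M in nhds 1, x ∈ (ψ i).ker.subgroupOf M :=
      ((h2 i).preimage continuous_subtype_val).mem_nhds (Subgroup.one_mem _)
    have e2 : ∀ᶠ x : M in nhds 1, E.φ x = 1 :=
      ((isOpen_discrete ({1} : Set E.G)).preimage E.φ.continuous_toFun).mem_nhds (map_one E.φ)
    filter_upwards [e1, e2] with x hx1 hx2
    have hx1' : ψ i x = 1 := hx1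
    simp [χ, hx1', hx2]
  refine ⟨⟨χ, hχ⟩, fun x => ?_, fun x hx => ?_⟩
  · have : E.α ((ψ i x).left.1 1 : E.H) = 1 := ((ψ i x).left.1 1).2
    change E.α (((ψ i x).left.1 1 : E.H) * β (E.φ x)) = _
    rw [map_mul, this, one_mul, hβ]
  · change ((ψ i x).left.1 1 : E.H) * β (E.φ x) = _
    rw [hL x hx, map_one, mul_one]

end

end SemiFree

/-! ### Moving elements into `M` by commutators. -/

namespace SemiFree

open TwistedWreath

/-- Each nontrivial finite split embedding problem for `M` has a jointly onto family of `m`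
solutions. -/
def HasJointlyOntoSolutions (M : Type u) [Group M] [TopologicalSpace M] (m : Cardinal.{u}) : Prop :=
  ∀ E : FiniteEmbeddingProblem M, E.IsSplit → E.IsNontrivial →
    ∃ (ι : Type u) (ψ : ι → M →ₜ* E.H), #ι = m ∧ (∀ i, E.IsSolution (ψ i)) ∧
      JointlyOnto (E.φ : M →* E.G).ker E.α.ker (fun i => (ψ i : M → E.H))

lemma notMem_map_mk' {F : Type*} [Group F] {M V L : Subgroup F} [L.Normal] (hM : M ≤ V) (hL : L ≤ V) {x : F}
    (hx : x ∉ V) : (x : F ⧸ L) ∉ M.map (QuotientGroup.mk' L) := by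
  rintro ⟨y, hy, e⟩
  have h1 : y⁻¹ * x ∈ L := QuotientGroup.eq.1 e
  exact hx (by simpa using V.mul_mem (hM hy) (hL h1))

variable {F : Type u} [Group F] [TopologicalSpace F] [IsTopologicalGroup F] [CompactSpace F]

lemma normalCore_isOpen {V : Subgroup F} (hV : IsOpen (V : Set F)) :
    IsOpen (V.normalCore : Set F) := by
  have := finiteIndex_of_isOpen hV
  exact Subgroup.isOpen_of_isClosed_of_finiteIndex _
    (V.normalCore_isClosed (V.isClosed_of_isOpen hV))

variable [TotallyDisconnectedSpace F]

lemma exists_openNormal_le_of_embeddingProblem {M : Subgroup F} (E : FiniteEmbeddingProblem M)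
    {V : Subgroup F} (hV : IsOpen (V : Set F)) :
    ∃ L : Subgroup F, L.Normal ∧ IsOpen (L : Set F) ∧ L ≤ V ∧
      ∀ x : M, (x : F) ∈ L → E.φ x = 1 := by
  have hk : IsOpen ((E.φ : M →* E.G).ker : Set M) :=
    (isOpen_discrete ({1} : Set E.G)).preimage E.φ.continuous_toFun
  obtain ⟨U, hn, hU, hle⟩ := exists_openNormal_subgroupOf_le hk
  exact ⟨U ⊓ V.normalCore, inferInstance, hU.inter (normalCore_isOpen hV),
    inf_le_right.trans V.normalCore_le, fun x hx => hle x hx.1⟩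

lemma exists_isOpen_notMem {M : Subgroup F} (hM : IsClosed (M : Set F)) {x : F} (hx : x ∉ M) :
    ∃ V : Subgroup F, IsOpen (V : Set F) ∧ M ≤ V ∧ x ∉ V := by
  by_contra h
  push Not at h
  exact hx (mem_of_forall_isOpen hM h)

/-- If `c` maps `L` to `M` and preserves the value at `1` of the elements supported on the image
of `M`, then the wreath product construction yields solutions for `M`. -/
lemma IsSemiFree.hasJointlyOntoSolutions_of_word (hF : IsSemiFree F) {M : Subgroup F} (c : F → F)
    {V : Subgroup F} (hV : IsOpen (V : Set F)) (hcM : ∀ l, c l ∈ M)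
    (hcL : ∀ (L : Subgroup F), L.Normal → ∀ l ∈ L, c l ∈ L)
    (h : ∀ (L : Subgroup F) [L.Normal], L ≤ V → ∀ {A : Type u} [Group A]
      (η : M.map (QuotientGroup.mk' L) →* MulAut A) (ψ : F →* Wreath η),
      (∀ x, (ψ x).right = (x : F ⧸ L)) → ∀ (a : A), ∀ l ∈ L,
      ψ l = SemidirectProduct.inl (single η a) → (ψ (c l)).left.1 1 = a) :
    HasJointlyOntoSolutions M (rank F) := by
  intro E hs hn
  obtain ⟨L, hLn, hLo, hLV, hL⟩ := exists_openNormal_le_of_embeddingProblem E hV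
  obtain ⟨η, ι, ψ, hι, -, hr, -, hj, hχ⟩ := hF.exists_wreath_family E hs hn hLo hL
  choose χ hsol hval using hχ
  refine ⟨ι, χ, hι, hsol, fun J a ha => ?_⟩
  obtain ⟨l, hl, hlJ⟩ := hj J (fun i => SemidirectProduct.inl (single η ⟨a i, ha i⟩))
    (fun i => by simp [MonoidHom.mem_ker])
  refine ⟨⟨c l, hcM l⟩, hL ⟨c l, hcM l⟩ (hcL L hLn l hl), fun i hi => ?_⟩
  change χ i _ = _
  rw [hval i _ (hcL L hLn l hl), h L hLV η (ψ i) (hr i) ⟨a i, ha i⟩ l hl (hlJ i hi)]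

/-- A closed normal subgroup with nontrivial abelian quotient. -/
lemma IsSemiFree.hasJointlyOntoSolutions_of_commutator (hF : IsSemiFree F) {M : Subgroup F}
    (hM : IsClosed (M : Set F)) {x : F} (hx : x ∉ M) (hc : ∀ l, l * (x * l⁻¹ * x⁻¹) ∈ M) :
    HasJointlyOntoSolutions M (rank F) := by
  obtain ⟨V, hV, hMV, hxV⟩ := exists_isOpen_notMem hM hx
  refine hF.hasJointlyOntoSolutions_of_word _ hV hc
    (fun L hn l hl => L.mul_mem hl (hn.conj_mem _ (L.inv_mem hl) x)) ?_
  intro L _ hLV A _ η ψ hr a l hl e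
  -- `x` is outside `V`, which contains `ML`, so `single` vanishes at `x⁻¹` and the commutator keeps
  -- its value at `1`.
  have h1 : ((x : F ⧸ L))⁻¹ * 1 ∉ M.map (QuotientGroup.mk' L) := by
    rw [mul_one, inv_mem_iff]
    exact notMem_map_mk' hMV hLV hxV
  simp only [map_mul, map_inv]
  rw [left_mul_conj_inv _ _ _ (by simp [e]) (by
    rw [hr, e, SemidirectProduct.left_inl, single_of_notMem _ _ h1]), e,
    SemidirectProduct.left_inl, single_one]

/-- A closed subgroup containing the double commutators with two suitable elements. -/
lemma IsSemiFree.hasJointlyOntoSolutions_of_double_commutator (hF : IsSemiFree F)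
    {M : Subgroup F} (hM : IsClosed (M : Set F)) {x y : F} (hx : x ∉ M) (hy : y ∉ M)
    (hyx : y * x ∉ M)
    (hc : ∀ l, l * (x * l⁻¹ * x⁻¹) * (y * (l * (x * l⁻¹ * x⁻¹))⁻¹ * y⁻¹) ∈ M) :
    HasJointlyOntoSolutions M (rank F) := by
  obtain ⟨V, hV, hMV, hxV⟩ := exists_isOpen_notMem hM hx
  obtain ⟨V', hV', hMV', hyV'⟩ := exists_isOpen_notMem hM hy
  obtain ⟨V'', hV'', hMV'', hyxV''⟩ := exists_isOpen_notMem hM hyx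
  have hcL : ∀ (L : Subgroup F), L.Normal → ∀ z, ∀ l ∈ L, l * (z * l⁻¹ * z⁻¹) ∈ L :=
    fun L hn z l hl => L.mul_mem hl (hn.conj_mem _ (L.inv_mem hl) z)
  refine hF.hasJointlyOntoSolutions_of_word _
    (V := V ⊓ (V' ⊓ V'')) (hV.inter (hV'.inter hV'')) hc
    (fun L hn l hl => hcL L hn y _ (hcL L hn x l hl)) ?_
  intro L _ hLV A _ η ψ hr a l hl e
  have hG : ∀ z : F, z ∉ V ⊓ (V' ⊓ V'') → ((z : F ⧸ L))⁻¹ ∉ M.map (QuotientGroup.mk' L) := by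
    intro z hz
    rw [inv_mem_iff]
    exact notMem_map_mk' (le_inf hMV (le_inf hMV' hMV'')) hLV hz
  have h1 := hG x fun h => hxV h.1
  have h2 := hG y fun h => hyV' h.2.1
  have h3 := hG (y * x) fun h => hyxV'' h.2.2
  set v := ψ l
  set v₁ := ψ (l * (x * l⁻¹ * x⁻¹)) with hv₁
  have ev₁ : v₁ = v * (ψ x * v⁻¹ * (ψ x)⁻¹) := by simp [hv₁, v]
  have hvr : v.right = 1 := by simp [e]
  have hv₁r : v₁.right = 1 := by simp [ev₁, hvr]
  have h4 : v₁.left.1 1 = a := by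
    rw [ev₁, left_mul_conj_inv _ _ _ hvr (by
      rw [hr, e, SemidirectProduct.left_inl, mul_one, single_of_notMem _ _ h1]), e,
      SemidirectProduct.left_inl, single_one]
  -- The outer commutator keeps the value at `1` if the inner one vanishes at `y⁻¹`. There it
  -- involves `v` at `y⁻¹` and at `(y * x)⁻¹`, whence the conditions on `y` and `y * x`.
  have h5 : v₁.left.1 (y : F ⧸ L)⁻¹ = 1 := by
    rw [ev₁, left_mul_conj_inv _ _ _ hvr (by
      rw [hr, e, SemidirectProduct.left_inl, ← mul_inv_rev, ← QuotientGroup.mk_mul,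
        single_of_notMem _ _ h3]), e, SemidirectProduct.left_inl, single_of_notMem _ _ h2]
  rw [map_mul ψ, ← hv₁, map_mul, map_mul, map_inv, map_inv, ← hv₁,
    left_mul_conj_inv _ _ _ hv₁r (by rw [hr, mul_one, h5]), h4]

/-- If `K` is covered by `M` and a closed set that does not contain `1` then `M ⊓ K` is open in
`K`. -/
lemma exists_openNormal_inf_le {M K : Subgroup F} {C : Set F} (hC : IsClosed C)
    (h1 : (1 : F) ∉ C) (h : ∀ x ∈ K, x ∈ M ∨ x ∈ C) :
    ∃ E : Subgroup F, E.Normal ∧ IsOpen (E : Set F) ∧ K ⊓ E ≤ M := by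
  obtain ⟨E, hn, hE, hle⟩ := exists_openNormal_subset hC.isOpen_compl h1
  exact ⟨E, hn, hE, fun x hx => (h x hx.1).resolve_right fun h' => hle hx.2 h'⟩

/-- The diamond theorem for a closed subgroup that is not open. -/
lemma IsSemiFree.hasJointlyOntoSolutions_of_diamond (hF : IsSemiFree F)
    {M : Subgroup F} (hM : IsClosed (M : Set F)) (hMo : ¬ IsOpen (M : Set F)) {M₁ M₂ : Subgroup F}
    (hn₁ : M₁.Normal) (hn₂ : M₂.Normal) (hle : M₁ ⊓ M₂ ≤ M) (h₁ : ¬ M₁ ≤ M) (h₂ : ¬ M₂ ≤ M) :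
    HasJointlyOntoSolutions M (rank F) := by
  have key : ∀ N₁ N₂ : Subgroup F, N₁.Normal → N₂.Normal → N₁ ⊓ N₂ ≤ M → ∀ x ∈ N₁, ∀ y ∈ N₂,
      x ∉ M → y ∉ M → y * x ∉ M → HasJointlyOntoSolutions M (rank F) := by
    intro N₁ N₂ hn₁ hn₂ hle x hx y hy hxM hyM hyxM
    refine hF.hasJointlyOntoSolutions_of_double_commutator hM hxM hyM hyxM fun l => hle ?_
    have h1 : l * (x * l⁻¹ * x⁻¹) ∈ N₁ := by
      have : l * (x * l⁻¹ * x⁻¹) = l * x * l⁻¹ * x⁻¹ := by group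
      rw [this]
      exact N₁.mul_mem (hn₁.conj_mem x hx l) (N₁.inv_mem hx)
    refine ⟨N₁.mul_mem h1 (hn₁.conj_mem _ (N₁.inv_mem h1) y), ?_⟩
    generalize l * (x * l⁻¹ * x⁻¹) = k
    have : k * (y * k⁻¹ * y⁻¹) = k * y * k⁻¹ * y⁻¹ := by group
    rw [this]
    exact N₂.mul_mem (hn₂.conj_mem y hy k) (N₂.inv_mem hy)
  obtain ⟨x, hx, hxM⟩ := SetLike.not_le_iff_exists.1 h₁
  obtain ⟨y, hy, hyM⟩ := SetLike.not_le_iff_exists.1 h₂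
  by_contra hcon
  -- If no `z` in `M₁` can replace `x` beside this `y`, then `M₁` is covered by `M` and a closed set
  -- missing `1`, so `M₁ ⊓ E ≤ M` with `E` open normal. The same argument for the pair `M₁`, `E`,
  -- now with `x` fixed, forces `M` to be open.
  have hcl : IsClosed {z : F | y * z ∈ M} := hM.preimage (continuous_const_mul y)
  obtain ⟨E, hEn, hE, hEle⟩ := exists_openNormal_inf_le (M := M) (K := M₁) hcl (by simpa using hyM)
    fun z hz => by
      by_contra h
      simp only [Set.mem_ofPred_eq, not_or] at h
      exact hcon (key M₁ M₂ hn₁ hn₂ hle z hz y hy h.1 hyM h.2)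
  have hcl' : IsClosed {z : F | z * x ∈ M} := hM.preimage (continuous_mul_const x)
  obtain ⟨E', -, hE', hEle'⟩ := exists_openNormal_inf_le (M := M) (K := E) hcl'
    (by simpa using hxM) fun z hz => by
      by_contra h
      simp only [Set.mem_ofPred_eq, not_or] at h
      exact hcon (key M₁ E hn₁ hEn hEle x hx z hz hxM h.1 h.2)
  exact hMo (Subgroup.isOpen_mono hEle' (hE.inter hE'))

end SemiFree

/-! ### Large independent subfamilies when few homomorphisms kill the core. -/

namespace SemiFree

open TwistedWreath

/-- Joint surjectivity of the subfamily on `S`. -/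
def JointlyOntoOn {F H ι : Type*} [Group F] [Group H] (K : Subgroup F) (A : Subgroup H)
    (ψ : ι → F → H) (S : Set ι) : Prop :=
  ∀ J : Finset ι, (J : Set ι) ⊆ S → ∀ a : ι → H, (∀ i, a i ∈ A) →
    ∃ x ∈ K, ∀ i ∈ J, ψ i x = a i

lemma JointlyOntoOn.jointlyOnto {F H ι : Type*} [Group F] [Group H] {K : Subgroup F}
    {A : Subgroup H} {ψ : ι → F → H} {S : Set ι} (h : JointlyOntoOn K A ψ S) :
    JointlyOnto K A (fun i : S => ψ i) := by
  classical
  intro J a ha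
  obtain ⟨x, hx, h'⟩ := h (J.map (Function.Embedding.subtype _)) (by
    intro i hi
    simp only [Finset.coe_map, Set.mem_image] at hi
    obtain ⟨j, -, rfl⟩ := hi
    exact j.2) (fun i => if hi : i ∈ S then a ⟨i, hi⟩ else 1)
    (fun i => by split_ifs; exacts [ha _, A.one_mem])
  refine ⟨x, hx, fun i hi => ?_⟩
  exact (h' i (by simpa using hi)).trans (dif_pos i.2)

lemma exists_maximal_jointlyOntoOn {F H ι : Type*} [Group F] [Group H] (K : Subgroup F)
    (A : Subgroup H) (ψ : ι → F → H) : ∃ S, Maximal (JointlyOntoOn K A ψ) S := by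
  refine zorn_subset {S | JointlyOntoOn K A ψ S} fun c hcs hc => ?_
  rcases c.eq_empty_or_nonempty with rfl | hne
  · refine ⟨∅, fun J hJ a _ => ⟨1, K.one_mem, fun i hi => (hJ hi).elim⟩, by simp⟩
  · refine ⟨⋃₀ c, fun J hJ a ha => ?_, fun s hs => Set.subset_sUnion_of_mem hs⟩
    obtain ⟨s, hs, hJs⟩ := hc.directedOn.exists_mem_subset_of_finset_subset_biUnion hne
      (f := id) (by simpa [Set.sUnion_eq_biUnion] using hJ)
    exact hcs hs J hJs a ha

/-- A homomorphism that is onto on the common kernel of finitely many members can be added. -/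
lemma JointlyOntoOn.insert {F H ι : Type*} [Group F] [Group H] {K : Subgroup F} {A : Subgroup H}
    {ψ : ι → F →* H} {S : Set ι} (h : JointlyOntoOn K A (fun i => (ψ i : F → H)) S) {i : ι}
    (hK : ∀ x ∈ K, ψ i x ∈ A)
    (hi : ∀ J : Finset ι, (J : Set ι) ⊆ S → A ≤ (K ⊓ ⨅ j ∈ J, (ψ j).ker).map (ψ i)) :
    JointlyOntoOn K A (fun i => (ψ i : F → H)) (insert i S) := by
  classical
  intro J hJ a ha
  have hJ' : ((J.erase i : Finset ι) : Set ι) ⊆ S := by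
    intro j hj
    simp only [Finset.coe_erase, Set.mem_sdiff, Set.mem_singleton_iff] at hj
    exact (hJ hj.1).resolve_left hj.2
  obtain ⟨x, hx, hxJ⟩ := h _ hJ' a ha
  obtain ⟨y, hy, e⟩ := hi _ hJ' (A.mul_mem (ha i) (A.inv_mem (hK x hx)))
  refine ⟨y * x, K.mul_mem hy.1 hx, fun j hj => ?_⟩
  rcases eq_or_ne j i with rfl | hne
  · simp [e]
  · have h1 : ψ j y = 1 := by
      have h2 : y ∈ ⨅ j ∈ J.erase i, (ψ j).ker := hy.2
      simp only [Subgroup.mem_iInf] at h2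
      exact h2 j (Finset.mem_erase.2 ⟨hne, hj⟩)
    have h3 : ψ j x = a j := hxJ j (Finset.mem_erase.2 ⟨hne, hj⟩)
    simp [h1, h3]

section

variable {F : Type u} [Group F] [TopologicalSpace F] [IsTopologicalGroup F]

/-- Modulo `N` the group `F` has, up to open subgroups, few homomorphisms to finite groups. -/
def FewHoms (N : Subgroup F) (m : Cardinal.{u}) : Prop :=
  (∀ (U : Subgroup F), U.Normal → IsOpen (U : Set F) → ∀ (T : Type u) [Group T] [Finite T],
      #{χ : OpenHom F T // N ⊓ U ≤ χ.1.ker} < ℵ₀) ∨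
  ∃ κ < m, ℵ₀ ≤ κ ∧ ∀ (U : Subgroup F), U.Normal → IsOpen (U : Set F) →
    ∀ (T : Type u) [Group T] [Finite T], #{χ : OpenHom F T // N ⊓ U ≤ χ.1.ker} ≤ κ

/-- If few homomorphisms kill `N` then a jointly onto family on `L` of large cardinality has
a subfamily of the same cardinality that is jointly onto on `N ⊓ L`. -/
lemma FewHoms.exists_jointlyOnto {N : Subgroup F} {m : Cardinal.{u}} (hN : FewHoms N m)
    (hNn : N.Normal) (hm : ℵ₀ ≤ m) {W ι : Type u} [Group W] [Finite W] {A : Subgroup W}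
    {L : Subgroup F} (hLn : L.Normal) (hL : IsOpen (L : Set F)) (ψ : ι → F →* W) (hι : #ι = m)
    (hψo : ∀ i, IsOpen ((ψ i).ker : Set F)) (hψs : ∀ i, Function.Surjective (ψ i))
    (hLA : ∀ i, ∀ x ∈ L, ψ i x ∈ A) (hψ : JointlyOnto L A (fun i => (ψ i : F → W))) :
    ∃ S : Set ι, #S = m ∧ JointlyOnto (N ⊓ L) A (fun i : S => (ψ i : F → W)) := by
  classical
  obtain ⟨S, hS, hmax⟩ := exists_maximal_jointlyOntoOn (N ⊓ L) A (fun i => (ψ i : F → W))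
  refine ⟨S, le_antisymm (hι ▸ mk_set_le S) (not_lt.1 fun hlt => ?_), hS.jointlyOnto⟩
  -- An index outside the maximal `S` cannot be added, so on the common kernel of finitely many
  -- members of `S` its map misses part of `A`. The sets `B` sort these indices by that finite set
  -- and by the image.
  let B : Finset S × Subgroup W → Set ι := fun p =>
    {i | (N ⊓ (L ⊓ ⨅ j ∈ p.1, (ψ j).ker)).map (ψ i) = p.2 ∧ ¬ A ≤ p.2}
  have hcover : Sᶜ ⊆ ⋃ p, B p := by
    intro i hi
    by_contra hcon
    refine hi (hmax (hS.insert (i := i) (fun x hx => hLA i x hx.2) fun J hJ => ?_)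
      (Set.subset_insert i S) (Set.mem_insert i S))
    by_contra hle
    let J' : Finset S := J.subtype (· ∈ S)
    have hJ' : ⨅ j ∈ J', (ψ j).ker ≤ ⨅ j ∈ J, (ψ j).ker := le_iInf₂ fun j hj =>
      iInf₂_le (f := fun (j : S) (_ : j ∈ J') => (ψ j).ker) ⟨j, hJ hj⟩ (by simpa [J'])
    refine hcon (Set.mem_iUnion.2
      ⟨(J', (N ⊓ (L ⊓ ⨅ j ∈ J', (ψ j).ker)).map (ψ i)), rfl, fun h => hle (h.trans ?_)⟩)
    rw [← inf_assoc]
    exact Subgroup.map_mono (inf_le_inf_left _ hJ')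
  have hB : ∀ p, ∃ (U : Subgroup F) (T : Type u) (_ : Group T) (_ : Finite T),
      U.Normal ∧ IsOpen (U : Set F) ∧ #(B p) ≤ #{χ : OpenHom F T // N ⊓ U ≤ χ.1.ker} := by
    rintro ⟨J, V⟩
    have hUn : (L ⊓ ⨅ j ∈ J, (ψ j).ker).Normal := by
      have : (⨅ j ∈ J, (ψ j).ker).Normal :=
        Subgroup.normal_iInf_normal fun j => Subgroup.normal_iInf_normal fun _ => inferInstance
      infer_instance
    have hUo : IsOpen ((L ⊓ ⨅ j ∈ J, (ψ j).ker : Subgroup F) : Set F) := by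
      refine hL.inter ?_
      have : ((⨅ j ∈ J, (ψ j).ker : Subgroup F) : Set F) = ⋂ j ∈ J, ((ψ j).ker : Set F) := by
        simp [Subgroup.coe_iInf]
      exact this ▸ isOpen_biInter_finset fun j _ => hψo j
    rcases (B (J, V)).eq_empty_or_nonempty with hempty | ⟨i₀, hi₀, hAV⟩
    · exact ⟨_, PUnit, inferInstance, inferInstance, hUn, hUo, by simp [hempty]⟩
    have hV : V.Normal := by
      have : (N ⊓ (L ⊓ ⨅ j ∈ J, (ψ j).ker)).Normal := inferInstance
      have h := this.map _ (hψs i₀)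
      rwa [hi₀] at h
    -- Composed with `W → W ⧸ V`, the members of `B (J, V)` kill `N ⊓ U`. They remain distinct,
    -- since joint surjectivity on `L` gives an `x` that one of them sends into `A` outside `V` and
    -- another to `1`.
    refine ⟨_, W ⧸ V, inferInstance, inferInstance, hUn, hUo, ?_⟩
    have hker : ∀ i : ι, (ψ i).ker ≤ ((QuotientGroup.mk' V).comp (ψ i)).ker := fun i x hx => by
      simp [MonoidHom.mem_ker, show ψ i x = 1 from hx]
    let f : B (J, V) → {χ : OpenHom F (W ⧸ V) // N ⊓ (L ⊓ ⨅ j ∈ J, (ψ j).ker) ≤ χ.1.ker} :=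
      fun i => ⟨⟨(QuotientGroup.mk' V).comp (ψ i), Subgroup.isOpen_mono (hker i) (hψo i)⟩,
        fun x hx => (QuotientGroup.eq_one_iff (ψ i x)).2 (by
          have h := Subgroup.mem_map_of_mem (ψ i) hx
          rwa [i.2.1] at h)⟩
    refine mk_le_of_injective (f := f) fun i i' h => by_contra fun hne => ?_
    obtain ⟨w, hw, hwV⟩ := SetLike.not_le_iff_exists.1 hAV
    obtain ⟨x, -, hx⟩ := hψ {i.1, i'.1} (fun k => if k = i.1 then w else 1)
      (fun k => by split_ifs; exacts [hw, A.one_mem])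
    have h1 : ψ i x = w := (hx i (by simp)).trans (by simp)
    have h2 : ψ i' x = 1 := (hx i' (by simp)).trans (if_neg fun e => hne (Subtype.ext e.symm))
    have h3 : (ψ i x : W ⧸ V) = (ψ i' x : W ⧸ V) :=
      DFunLike.congr_fun (congrArg (fun χ => χ.1.1) h) x
    rw [h1, h2, QuotientGroup.mk_one] at h3
    exact hwV ((QuotientGroup.eq_one_iff w).1 h3)
  have hcompl : m ≤ #(Sᶜ : Set ι) := by
    by_contra hc
    have := add_lt_of_lt hm hlt (not_le.1 hc)
    rw [mk_sum_compl, hι] at this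
    exact lt_irrefl _ this
  have hle : #(Sᶜ : Set ι) ≤ #(⋃ p, B p) := mk_le_mk_of_subset hcover
  have hinf : ∀ κ < m, ℵ₀ ≤ κ → (∀ p, #(B p) ≤ κ) → False := by
    intro κ hκ h0 hBκ
    have h1 : #(Finset S × Subgroup W) ≤ max ℵ₀ #S := by
      rw [mk_prod, lift_id, lift_id]
      refine (mul_le_max _ _).trans (max_le (max_le (mk_finset_le_max _) ?_) (le_max_left _ _))
      exact (lt_aleph0_of_finite _).le.trans (le_max_left _ _)
    have h2 : #(⋃ p, B p) ≤ max (max (max ℵ₀ #S) κ) ℵ₀ :=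
      ((mk_iUnion_le _).trans (mul_le_mul' h1 (ciSup_le' hBκ))).trans (mul_le_max _ _)
    have h0m : ℵ₀ < m := h0.trans_lt hκ
    exact absurd (hcompl.trans (hle.trans h2))
      (not_le.2 (max_lt (max_lt (max_lt h0m hlt) hκ) h0m))
  -- The complement of `S` has `m` elements. With finite sets `B`, a finite `S` would make it
  -- finite, while an infinite `S` gives `ℵ₀ < m`, so the bound `κ = ℵ₀` applies.
  rcases hN with hfin | ⟨κ, hκ, h0, hbound⟩
  · have hBfin : ∀ p, #(B p) < ℵ₀ := fun p =>
      let ⟨U, T, _, _, hUn, hUo, h⟩ := hB p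
      h.trans_lt (hfin U hUn hUo T)
    rcases finite_or_infinite S with hSf | hSi
    · have : ∀ p, Finite (B p) := fun p => lt_aleph0_iff_finite.1 (hBfin p)
      have h1 : (⋃ p, B p).Finite := Set.finite_iUnion fun p => (B p).toFinite
      exact absurd (hm.trans (hcompl.trans hle)) (not_le.2 h1.lt_aleph0)
    · exact hinf ℵ₀ ((aleph0_le_mk S).trans_lt hlt) le_rfl fun p => (hBfin p).le
  · exact hinf κ hκ h0 fun p =>
      let ⟨U, T, _, _, hUn, hUo, h⟩ := hB p
      h.trans (hbound U hUn hUo T)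

/-- If `F / N` is finitely generated then few homomorphisms kill `N`. -/
lemma fewHoms_of_topologicallyFG [CompactSpace F] {N : Subgroup F} [N.Normal]
    (hfg : TopologicallyFG (F ⧸ N)) (m : Cardinal.{u}) : FewHoms N m := by
  left
  intro U _ hU T _ _
  obtain ⟨X, hXf, hX⟩ := hfg
  have := finite_quotient_of_isOpen hU
  have h2 : ∀ z : F ⧸ U, ∃ n ∈ N, (∃ n' ∈ N, (n' : F ⧸ U) = z) → (n : F ⧸ U) = z := by
    intro z
    by_cases h : ∃ n' ∈ N, (n' : F ⧸ U) = z
    · obtain ⟨n, hn, e⟩ := h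
      exact ⟨n, hn, fun _ => e⟩
    · exact ⟨1, N.one_mem, fun h' => (h h').elim⟩
  choose r hrN hr using h2
  have : Finite X := hXf
  -- Such a homomorphism is determined on `N` by representatives of the finite group `NU/U`, and
  -- beyond `N` by lifts of the generators of `F ⧸ N`.
  let f : {χ : OpenHom F T // N ⊓ U ≤ χ.1.ker} → (X → T) × (F ⧸ U → T) := fun χ =>
    (fun x => χ.1.1 x.1.out, fun z => χ.1.1 (r z))
  have hf : Function.Injective f := by
    intro χ χ' h
    have hopen := isOpen_eqLocus χ.1 χ'.1
    have hNU : N ⊓ U ≤ χ.1.1.eqLocus χ'.1.1 := fun x hx =>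
      (show χ.1.1 x = 1 from χ.2 hx).trans (show χ'.1.1 x = 1 from χ'.2 hx).symm
    have hNE : N ≤ χ.1.1.eqLocus χ'.1.1 := by
      intro n hn
      have h1 : r (n : F ⧸ U) ∈ χ.1.1.eqLocus χ'.1.1 := congrFun (congrArg Prod.snd h) (n : F ⧸ U)
      have h2 : (r (n : F ⧸ U))⁻¹ * n ∈ U := QuotientGroup.eq.1 (hr n ⟨n, hn, rfl⟩)
      simpa using Subgroup.mul_mem _ h1 (hNU ⟨N.mul_mem (N.inv_mem (hrN n)) hn, h2⟩)
    have hmap : IsOpen (((χ.1.1.eqLocus χ'.1.1).map (QuotientGroup.mk' N) :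
        Subgroup (F ⧸ N)) : Set (F ⧸ N)) := QuotientGroup.isOpenMap_coe _ hopen
    have htop : (⊤ : Subgroup (F ⧸ N)) ≤ (χ.1.1.eqLocus χ'.1.1).map (QuotientGroup.mk' N) := by
      rw [← show _ = ⊤ from hX]
      refine Subgroup.topologicalClosure_minimal _ ((Subgroup.closure_le _).2 fun x hx => ?_)
        (Subgroup.isClosed_of_isOpen _ hmap)
      exact ⟨x.out, congrFun (congrArg Prod.fst h) ⟨x, hx⟩, QuotientGroup.out_eq' x⟩
    refine Subtype.ext (Subtype.ext (MonoidHom.ext fun x => ?_))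
    obtain ⟨y, hy, e⟩ := htop (Subgroup.mem_top (x : F ⧸ N))
    have h3 := Subgroup.mul_mem _ hy (hNE (QuotientGroup.eq.1 e))
    rw [mul_inv_cancel_left] at h3
    exact h3
  have : Finite {χ : OpenHom F T // N ⊓ U ≤ χ.1.ker} := Finite.of_injective f hf
  exact lt_aleph0_of_finite _

/-- If the weight of `F / M` is small then few homomorphisms kill the normal core of `M`. -/
lemma fewHoms_of_weight_lt [CompactSpace F] [TotallyDisconnectedSpace F] {M : Subgroup F}
    (hM : IsClosed (M : Set F)) (hMo : ¬ IsOpen (M : Set F)) {m : Cardinal.{u}}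
    (hw : weight M < m) : FewHoms M.normalCore m := by
  classical
  right
  rw [weight, if_neg hMo] at hw
  let 𝒱 := {U : Subgroup F // IsOpen (U : Set F) ∧ M ≤ U}
  have hinf : ℵ₀ ≤ #𝒱 := by
    by_contra h
    have : Finite 𝒱 := lt_aleph0_iff_finite.1 (not_le.1 h)
    have h1 : IsOpen (⋂ V : 𝒱, (V.1 : Set F)) := isOpen_iInter_of_finite fun V => V.2.1
    refine hMo (Subgroup.isOpen_mono (H₁ := ⨅ V : 𝒱, V.1) (fun x hx => ?_)
      (by rw [Subgroup.coe_iInf]; exact h1))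
    rw [Subgroup.mem_iInf] at hx
    exact mem_of_forall_isOpen hM fun V hV hMV => hx ⟨V, hV, hMV⟩
  refine ⟨#𝒱, hw, hinf, fun U _ hU T _ _ => ?_⟩
  have hVo : ∀ V : 𝒱, IsOpen ((V.1.normalCore ⊓ U : Subgroup F) : Set F) := fun V =>
    (normalCore_isOpen V.2.1).inter hU
  -- By compactness `χ` already kills `V.normalCore ⊓ U` for one open `V ≥ M`, so it is encoded by
  -- `V` and a function on a finite quotient.
  have hex : ∀ χ : {χ : OpenHom F T // M.normalCore ⊓ U ≤ χ.1.ker},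
      ∃ V : 𝒱, V.1.normalCore ⊓ U ≤ χ.1.1.ker := by
    intro χ
    have : Nonempty 𝒱 := ⟨⟨⊤, isOpen_univ, le_top⟩⟩
    refine exists_le_of_iInf_le (N := fun V : 𝒱 => V.1.normalCore ⊓ U) ?_
      (fun V => Subgroup.isClosed_of_isOpen _ (hVo V)) χ.1.2 (le_trans ?_ χ.2)
    · intro V V'
      refine ⟨⟨V.1 ⊓ V'.1, V.2.1.inter V'.2.1, le_inf V.2.2 V'.2.2⟩, ?_, ?_⟩
      · exact inf_le_inf_right _ (Subgroup.normalCore_mono inf_le_left)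
      · exact inf_le_inf_right _ (Subgroup.normalCore_mono inf_le_right)
    · intro x hx
      rw [Subgroup.mem_iInf] at hx
      refine ⟨fun g => mem_of_forall_isOpen hM fun V hV hMV => (hx ⟨V, hV, hMV⟩).1 g,
        (hx (Classical.arbitrary _)).2⟩
  choose V hV using hex
  let s : {χ : OpenHom F T // M.normalCore ⊓ U ≤ χ.1.ker} →
      Σ V : 𝒱, F ⧸ (V.1.normalCore ⊓ U) → T := fun χ =>
    ⟨V χ, QuotientGroup.lift _ χ.1.1 (hV χ)⟩
  have hs : ∀ χ (x : F), (s χ).2 (x : F ⧸ ((s χ).1.1.normalCore ⊓ U)) = χ.1.1 x :=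
    fun χ x => rfl
  have hinj : Function.Injective s := fun χ χ' h =>
    Subtype.ext (Subtype.ext (MonoidHom.ext fun x => by rw [← hs, ← hs, h]))
  refine (mk_le_of_injective hinj).trans ?_
  rw [mk_sigma]
  refine (sum_le_mk_mul_iSup _).trans ((mul_le_max _ _).trans ?_)
  refine max_le (max_le le_rfl ((ciSup_le' fun V => ?_).trans hinf)) hinf
  have := finite_quotient_of_isOpen (hVo V)
  exact (lt_aleph0_of_finite _).le

/-- Subgroups whose normal core is killed by few homomorphisms. -/
lemma IsSemiFree.hasJointlyOntoSolutions_of_fewHoms [CompactSpace F] [TotallyDisconnectedSpace F]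
    (hF : IsSemiFree F) {M : Subgroup F} (h : FewHoms M.normalCore (rank F)) :
    HasJointlyOntoSolutions M (rank F) := by
  intro E hs hn
  obtain ⟨L, hLn, hLo, -, hL⟩ := exists_openNormal_le_of_embeddingProblem E (V := ⊤) isOpen_univ
  obtain ⟨η, ι, ψ, hι, ho, hr, hsurj, hj, hχ⟩ := hF.exists_wreath_family E hs hn hLo hL
  choose χ hsol hval using hχ
  have := finite_quotient_of_isOpen hLo
  obtain ⟨S, hS, hSj⟩ := h.exists_jointlyOnto inferInstance hF.1 hLn hLo ψ hι ho hsurj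
    (fun i x hx => (hr i x).trans ((QuotientGroup.eq_one_iff x).2 hx)) hj
  refine ⟨S, fun i => χ i, hS, fun i => hsol i, fun J a ha => ?_⟩
  obtain ⟨x, hx, hxJ⟩ := hSj J (fun i => SemidirectProduct.inl (single η ⟨a i, ha i⟩))
    (fun i => by simp [MonoidHom.mem_ker])
  have hxM : x ∈ M := M.normalCore_le hx.1
  refine ⟨⟨x, hxM⟩, hL ⟨x, hxM⟩ hx.2, fun i hi => (hval i _ hx.2).trans ?_⟩
  have h1 : ψ i x = _ := hxJ i hi
  rw [h1, SemidirectProduct.left_inl, single_one]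

end

end SemiFree

/-! ### Countable rank, nilpotent quotients and sparse subgroups. -/

namespace SemiFree

/-- If each nontrivial finite split embedding problem is properly solvable then each of them has
infinitely many independent solutions. -/
lemma hasJointlyOntoSolutions_aleph0 {M : Type u} [Group M] [TopologicalSpace M]
    [IsTopologicalGroup M] [CompactSpace M]
    (h : ∀ E : FiniteEmbeddingProblem M, E.IsSplit → E.IsNontrivial →
      ∃ ψ : M →ₜ* E.H, E.IsProperSolution ψ) : HasJointlyOntoSolutions M ℵ₀ := by
  classical
  intro E hs hn
  let ι := {ψ : M →ₜ* E.H // E.IsSolution ψ}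
  let K := (E.φ : M →* E.G).ker
  let v : ι → M →* E.H := fun ψ => (ψ.1 : M →* E.H)
  obtain ⟨S, hS, hmax⟩ := exists_maximal_jointlyOntoOn K E.α.ker (fun ψ : ι => (v ψ : M → E.H))
  rcases finite_or_infinite S with hfin | hinf
  swap
  · obtain ⟨T, hTS, hT⟩ := le_mk_iff_exists_subset.1 (aleph0_le_mk S)
    refine ⟨T, fun i => i.1.1, hT, fun i => i.1.2, ?_⟩
    exact JointlyOntoOn.jointlyOnto (ψ := fun ψ : ι => (v ψ : M → E.H))
      fun J hJ => hS J (hJ.trans hTS)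
  exfalso
  obtain ⟨β, hβ⟩ := hs
  let U : Subgroup M := K ⊓ ⨅ ψ : S, (v ψ.1).ker
  have hUn : U.Normal := by
    have : (⨅ ψ : S, (v ψ.1).ker).Normal := Subgroup.normal_iInf_normal fun ψ => inferInstance
    exact inferInstanceAs (K ⊓ ⨅ ψ : S, (v ψ.1).ker).Normal
  have hUo : IsOpen (U : Set M) := by
    refine ((isOpen_discrete ({1} : Set E.G)).preimage E.φ.continuous_toFun).inter ?_
    have : ((⨅ ψ : S, (v ψ.1).ker : Subgroup M) : Set M) = ⋂ ψ : S, ((v ψ.1).ker : Set M) :=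
      Subgroup.coe_iInf
    exact this ▸ isOpen_iInter_of_finite fun ψ =>
      (isOpen_discrete ({1} : Set E.H)).preimage ψ.1.1.continuous_toFun
  have := finite_quotient_of_isOpen hUo
  let φ' : M ⧸ U →* E.G := QuotientGroup.lift U (E.φ : M →* E.G) inf_le_left
  -- If `S` is finite, `U` is open and the fibre product of `H` and `M ⧸ U` over `G` is a split
  -- problem over `M ⧸ U`. The first coordinate of a proper solution maps `U` onto Ker α, so it can
  -- be added to `S`; as a member of the maximal `S`, however, it kills `U`.
  let H' : Subgroup (E.H × (M ⧸ U)) :=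
    (E.α.comp (MonoidHom.fst _ _)).eqLocus (φ'.comp (MonoidHom.snd _ _))
  let _ : TopologicalSpace H' := ⊥
  have : DiscreteTopology H' := ⟨rfl⟩
  have : DiscreteTopology (M ⧸ U) := QuotientGroup.discreteTopology hUo
  let β' : M ⧸ U →* H' := ((β.comp φ').prod (MonoidHom.id _)).codRestrict H' fun g => hβ _
  let E' : FiniteEmbeddingProblem M :=
    { G := M ⧸ U
      H := H'
      φ := ⟨QuotientGroup.mk' U, QuotientGroup.continuous_mk⟩
      α := (MonoidHom.snd _ _).comp H'.subtype
      φ_surjective := QuotientGroup.mk'_surjective U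
      α_surjective := fun g => ⟨β' g, rfl⟩ }
  have hmem : ∀ a ∈ E.α.ker, ∃ z : H', z.1 = (a, 1) := fun a ha =>
    ⟨⟨(a, 1), by
      change E.α a = φ' 1
      rw [map_one]; exact ha⟩, rfl⟩
  obtain ⟨a, ha, ha1⟩ := E.α.ker.bot_or_exists_ne_one.resolve_left
    (FiniteEmbeddingProblem.ker_ne_bot hn)
  have hn' : E'.IsNontrivial := by
    intro hb
    obtain ⟨z, hz⟩ := hmem a ha
    have h1 : z = 1 := hb.1 (show z.1.2 = (1 : H').1.2 by rw [hz]; rfl)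
    rw [h1] at hz
    exact ha1 (congrArg Prod.fst hz).symm
  obtain ⟨ψ', hψ', hsurj⟩ := h E' ⟨β', fun g => rfl⟩ hn'
  have hc : Continuous fun x => (ψ' x).1.1 :=
    (continuous_of_discreteTopology (f := fun z : H' => z.1.1)).comp ψ'.continuous_toFun
  let ψ : M →ₜ* E.H := ⟨(MonoidHom.fst _ _).comp (H'.subtype.comp (ψ' : M →* H')), hc⟩
  have hψ2 : ∀ x, (ψ' x).1.2 = (x : M ⧸ U) := fun x => hψ' x
  have hψ : E.IsSolution ψ := by
    intro x
    have h1 : E.α (ψ' x).1.1 = φ' (ψ' x).1.2 := (ψ' x).2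
    rw [hψ2] at h1
    exact h1
  have hval : ∀ b ∈ E.α.ker, ∃ x ∈ U, ψ x = b := by
    intro b hb
    obtain ⟨z, hz⟩ := hmem b hb
    obtain ⟨x, hx⟩ := hsurj z
    refine ⟨x, ?_, ?_⟩
    · rw [← QuotientGroup.eq_one_iff, ← hψ2, hx, hz]
    · change (ψ' x).1.1 = b
      rw [hx, hz]
  have hmemS : (⟨ψ, hψ⟩ : ι) ∈ S := by
    refine hmax (JointlyOntoOn.insert (ψ := v) (i := ⟨ψ, hψ⟩) hS
      (fun x hx => (hψ x).trans hx) fun J hJ b hb => ?_) (Set.subset_insert _ S)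
      (Set.mem_insert _ S)
    obtain ⟨x, hx, e⟩ := hval b hb
    refine ⟨x, ⟨hx.1, ?_⟩, e⟩
    have h2 : x ∈ ⨅ ψ : S, (v ψ.1).ker := hx.2
    change x ∈ ⨅ j ∈ J, (v j).ker
    simp only [Subgroup.mem_iInf] at h2 ⊢
    exact fun j hj => h2 ⟨j, hJ hj⟩
  obtain ⟨x, hx, e⟩ := hval a ha
  have h2 : x ∈ ⨅ ψ : S, (v ψ.1).ker := hx.2
  rw [Subgroup.mem_iInf] at h2
  exact ha1 (e.symm.trans (h2 ⟨_, hmemS⟩))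

/-- In a finite nilpotent group, the Sylow subgroups for two different primes meet trivially and
are normal of index prime to the respective prime. -/
lemma exists_normal_inf_eq_bot {Q : Type*} [Group Q] [Finite Q] [Group.IsNilpotent Q] {p q : ℕ}
    [Fact p.Prime] [Fact q.Prime] (hpq : p ≠ q) :
    ∃ P P' : Subgroup Q, P.Normal ∧ P'.Normal ∧ ¬ p ∣ P.index ∧ ¬ q ∣ P'.index ∧ P ⊓ P' = ⊥ := by
  let P : Sylow p Q := default
  let P' : Sylow q Q := default
  have hn := Group.normalizerCondition_of_isNilpotent (G := Q)
  exact ⟨P, P', P.normal_of_normalizerCondition hn, P'.normal_of_normalizerCondition hn,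
    P.not_dvd_index, P'.not_dvd_index,
    (IsPGroup.disjoint_of_ne p q hpq _ _ P.isPGroup' P'.isPGroup').eq_bot⟩

section

variable {F : Type u} [Group F] [TopologicalSpace F]

/-- The intersection of the open normal subgroups containing `N` of index prime to `p`. -/
def primeToCore (N : Subgroup F) (p : ℕ) : Subgroup F :=
  ⨅ V : {V : Subgroup F // V.Normal ∧ IsOpen (V : Set F) ∧ N ≤ V ∧ ¬ p ∣ V.index}, V.1

lemma primeToCore_normal (N : Subgroup F) (p : ℕ) : (primeToCore N p).Normal :=
  Subgroup.normal_iInf_normal fun V => V.2.1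

lemma exists_dvd_index_of_indexExponent_ne_zero {M : Subgroup F} {p : Nat.Primes}
    (h : indexExponent M p ≠ 0) :
    ∃ U : Subgroup F, IsOpen (U : Set F) ∧ M ≤ U ∧ (p : ℕ) ∣ U.index := by
  by_contra hcon
  push Not at hcon
  refine h ?_
  rw [indexExponent, ← bot_eq_zero, iSup₂_eq_bot]
  intro U hU
  rw [padicValNat.eq_zero_of_not_dvd (hcon U hU.1 hU.2)]
  rfl

variable [IsTopologicalGroup F] [CompactSpace F]

/-- The subgroups `V` defining the core are closed under intersection. By compactness one of them
would lie in `U`, and `p` would divide its index. -/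
lemma not_primeToCore_le {N M : Subgroup F} {p : ℕ} (hp : p.Prime) {U : Subgroup F}
    (hU : IsOpen (U : Set F)) (hMU : M ≤ U) (hdvd : p ∣ U.index) : ¬ primeToCore N p ≤ M := by
  intro h
  have : Nonempty {V : Subgroup F // V.Normal ∧ IsOpen (V : Set F) ∧ N ≤ V ∧ ¬ p ∣ V.index} :=
    ⟨⟨⊤, inferInstance, isOpen_univ, le_top, by simpa using hp.one_lt.ne'⟩⟩
  have hd : Directed (· ≥ ·) fun V : {V : Subgroup F //
      V.Normal ∧ IsOpen (V : Set F) ∧ N ≤ V ∧ ¬ p ∣ V.index} => V.1 := by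
    rintro ⟨V, hVn, hV, hNV, hVp⟩ ⟨V', hVn', hV', hNV', hVp'⟩
    refine ⟨⟨V ⊓ V', inferInstance, hV.inter hV', le_inf hNV hNV', fun hd => ?_⟩,
      inf_le_left, inf_le_right⟩
    rw [← Subgroup.relIndex_mul_index (inf_le_right : V ⊓ V' ≤ V'), Subgroup.inf_relIndex_right]
      at hd
    rcases hp.dvd_mul.1 hd with h' | h'
    · exact hVp (h'.trans (Subgroup.relIndex_dvd_index_of_normal V V'))
    · exact hVp' h'
  obtain ⟨V, hV⟩ := exists_le_of_iInf_le hd (fun V => Subgroup.isClosed_of_isOpen _ V.2.2.1) hU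
    (h.trans hMU)
  exact V.2.2.2.2 (hdvd.trans (Subgroup.index_dvd_of_le hV))

lemma IsSparse.exists_le {M : Subgroup F} (hM : IsSparse M) {K₀ : Subgroup F}
    (hK₀ : IsOpen (K₀ : Set F)) (hMK₀ : M ≤ K₀) (n : ℕ) :
    ∃ K : Subgroup F, IsOpen (K : Set F) ∧ M ≤ K ∧ K ≤ K₀ ∧
      ∀ L : Subgroup F, IsOpen (L : Set F) → M ≤ L → L < K → n ≤ L.relIndex K := by
  -- If `K` were not inside `K₀`, then `K₀ ⊓ K` would be proper in `K` of index at most `K₀.index`.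
  obtain ⟨K, hK, hMK, h⟩ := hM.2.2 (max n (K₀.index + 1))
  refine ⟨K, hK, hMK, ?_, fun L hL hML hlt => (le_max_left _ _).trans (h L hL hML hlt)⟩
  by_contra hle
  have h1 := (le_max_right _ _).trans (h (K₀ ⊓ K) (hK₀.inter hK) (le_inf hMK₀ hMK)
    (lt_of_le_of_ne inf_le_right fun e => hle (inf_eq_right.1 e)))
  rw [Subgroup.inf_relIndex_right] at h1
  have := (finiteIndex_of_isOpen hK₀).index_ne_zero
  have h2 := Subgroup.relIndex_le_of_le_right (H := K₀) (le_top : K ≤ ⊤)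
    (by rwa [Subgroup.relIndex_top_right])
  rw [Subgroup.relIndex_top_right] at h2
  omega

lemma IsSparse.not_isOpen {M : Subgroup F} (hM : IsSparse M) : ¬ IsOpen (M : Set F) :=
  fun h => hM.2.1 (finiteIndex_of_isOpen h)

lemma finite_ge_of_isOpen {K : Subgroup F} (hK : IsOpen (K : Set F)) :
    Finite {U : Subgroup F // K ≤ U} := by
  have := finite_quotient_of_isOpen hK
  refine Finite.of_injective
    (fun U : {U : Subgroup F // K ≤ U} => {z : F ⧸ K | z.out ∈ U.1}) fun U U' h => ?_
  have key : ∀ (U : {U : Subgroup F // K ≤ U}) (x : F), (x : F ⧸ K).out ∈ U.1 ↔ x ∈ U.1 := by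
    intro U x
    have h1 : ((x : F ⧸ K).out)⁻¹ * x ∈ U.1 := U.2 (QuotientGroup.eq.1 (QuotientGroup.out_eq' _))
    constructor
    · intro h2; simpa using U.1.mul_mem h2 h1
    · intro h2; simpa using U.1.mul_mem h2 (U.1.inv_mem h1)
  ext x
  rw [← key U, ← key U']
  exact Set.ext_iff.1 h (x : F ⧸ K)

/-- Each open `U ≥ M` contains the witness `K` for `n = U.index + 1`, and each of these countably
many `K` has only finitely many overgroups. -/
lemma IsSparse.weight_le {M : Subgroup F} (hM : IsSparse M) : weight M ≤ ℵ₀ := by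
  rw [weight, if_neg hM.not_isOpen]
  choose K hK hMK h using hM.2.2
  have hle : ∀ U : {U : Subgroup F // IsOpen (U : Set F) ∧ M ≤ U}, K (U.1.index + 1) ≤ U.1 := by
    intro U
    by_contra hle
    have h1 := h (U.1.index + 1) (U.1 ⊓ K (U.1.index + 1)) (U.2.1.inter (hK _))
      (le_inf U.2.2 (hMK _)) (lt_of_le_of_ne inf_le_right fun e => hle (inf_eq_right.1 e))
    rw [Subgroup.inf_relIndex_right] at h1
    have := (finiteIndex_of_isOpen U.2.1).index_ne_zero
    have h2 := Subgroup.relIndex_le_of_le_right (H := U.1) (le_top : K (U.1.index + 1) ≤ ⊤)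
      (by rwa [Subgroup.relIndex_top_right])
    rw [Subgroup.relIndex_top_right] at h2
    omega
  have := fun n => finite_ge_of_isOpen (hK n)
  have : Countable {U : Subgroup F // IsOpen (U : Set F) ∧ M ≤ U} :=
    Function.Injective.countable (β := Σ n, {U : Subgroup F // K n ≤ U})
      (f := fun U => ⟨U.1.index + 1, U.1, hle U⟩) fun U U' e => by
        have := congrArg (fun z : Σ n, {U : Subgroup F // K n ≤ U} => z.2.1) e
        exact Subtype.ext this
  exact mk_le_aleph0

/-- A closed subgroup of infinite index is sparse if the index has finite exponents. -/
lemma isSparse_of_indexExponent_lt_top {M : Subgroup F} (hM : IsClosed (M : Set F))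
    (hMi : ¬ M.FiniteIndex) (h : ∀ p : Nat.Primes, indexExponent M p < ⊤) : IsSparse M := by
  refine ⟨hM, hMi, fun n => ?_⟩
  -- `U p` attains the full exponent of `p`. Below the intersection of the `U p` with `p < n`, no
  -- index can gain a prime factor less than `n`.
  have hmax : ∀ p : ℕ, ∃ U : Subgroup F, IsOpen (U : Set F) ∧ M ≤ U ∧ (p.Prime →
      ∀ V : Subgroup F, IsOpen (V : Set F) → M ≤ V →
        padicValNat p V.index ≤ padicValNat p U.index) := by
    intro p
    by_cases hp : p.Prime
    · obtain ⟨k, hk⟩ := ENat.ne_top_iff_exists.1 (h ⟨p, hp⟩).ne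
      let s : Set ℕ := {v | ∃ U : Subgroup F, (IsOpen (U : Set F) ∧ M ≤ U) ∧
        padicValNat p U.index = v}
      have hne : s.Nonempty := ⟨_, ⊤, ⟨isOpen_univ, le_top⟩, rfl⟩
      have hb : BddAbove s := by
        refine ⟨k, ?_⟩
        rintro _ ⟨U, hU, rfl⟩
        have h1 : (padicValNat p U.index : ℕ∞) ≤ indexExponent M ⟨p, hp⟩ :=
          le_iSup₂ (f := fun (U : Subgroup F) (_ : IsOpen (U : Set F) ∧ M ≤ U) =>
            (padicValNat p U.index : ℕ∞)) U hU
        rw [← hk] at h1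
        exact_mod_cast h1
      obtain ⟨U, hU, hUs⟩ := Nat.sSup_mem hne hb
      exact ⟨U, hU.1, hU.2, fun _ V hV hMV => hUs ▸ le_csSup hb ⟨V, ⟨hV, hMV⟩, rfl⟩⟩
    · exact ⟨⊤, isOpen_univ, le_top, fun h => (hp h).elim⟩
  choose U hU hMU hUmax using hmax
  have hKo : IsOpen ((⨅ p ∈ Finset.range n, U p : Subgroup F) : Set F) := by
    have : ((⨅ p ∈ Finset.range n, U p : Subgroup F) : Set F) =
        ⋂ p ∈ Finset.range n, (U p : Set F) := by simp [Subgroup.coe_iInf]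
    exact this ▸ isOpen_biInter_finset fun p _ => hU p
  refine ⟨⨅ p ∈ Finset.range n, U p, hKo, le_iInf₂ fun p _ => hMU p, fun L hL hML hlt => ?_⟩
  set K := ⨅ p ∈ Finset.range n, U p
  have hmul := Subgroup.relIndex_mul_index hlt.le
  have hL0 : L.index ≠ 0 := (finiteIndex_of_isOpen hL).index_ne_zero
  have hK0 : K.index ≠ 0 := (finiteIndex_of_isOpen hKo).index_ne_zero
  have hr0 : L.relIndex K ≠ 0 := fun h0 => hL0 (by rw [← hmul, h0, zero_mul])
  have hr1 : L.relIndex K ≠ 1 := fun h1 => hlt.not_ge (Subgroup.relIndex_eq_one.1 h1)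
  by_contra hcon
  have hp := Nat.minFac_prime hr1
  set p := (L.relIndex K).minFac
  have := Fact.mk hp
  have hpn : p < n := (Nat.minFac_le (Nat.pos_of_ne_zero hr0)).trans_lt (not_le.1 hcon)
  have hKU : K ≤ U p := iInf₂_le p (Finset.mem_range.2 hpn)
  have h1 : padicValNat p L.index = padicValNat p (L.relIndex K) + padicValNat p K.index := by
    rw [← hmul, padicValNat.mul hr0 hK0]
  have h2 : padicValNat p (U p).index ≤ padicValNat p K.index :=
    (padicValNat_dvd_iff_le hK0).1 (pow_padicValNat_dvd.trans (Subgroup.index_dvd_of_le hKU))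
  have h3 := hUmax p hp L hL hML
  have h4 : 1 ≤ padicValNat p (L.relIndex K) :=
    one_le_padicValNat_of_dvd hr0 (Nat.minFac_dvd _)
  omega

end

/-! ### The individual cases. -/

variable {F : Type u} [Group F] [TopologicalSpace F] [IsTopologicalGroup F] [CompactSpace F]
  [TotallyDisconnectedSpace F]

/-- Open subgroups of a semi-free group. -/
lemma IsSemiFree.hasJointlyOntoSolutions_of_isOpen (hF : IsSemiFree F) {M : Subgroup F}
    (hM : IsOpen (M : Set F)) : HasJointlyOntoSolutions M (rank F) := by
  have := finite_quotient_of_isOpen (normalCore_isOpen hM)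
  exact hF.hasJointlyOntoSolutions_of_fewHoms (fewHoms_of_topologicallyFG
    ⟨Set.univ, Set.finite_univ, eq_top_iff.2 fun x _ =>
      Subgroup.le_topologicalClosure _ (Subgroup.subset_closure (Set.mem_univ x))⟩ _)

/-- Subgroups of small weight. -/
lemma IsSemiFree.hasJointlyOntoSolutions_of_weight_lt (hF : IsSemiFree F) {M : Subgroup F}
    (hM : IsClosed (M : Set F)) (hw : weight M < rank F) :
    HasJointlyOntoSolutions M (rank F) := by
  by_cases hMo : IsOpen (M : Set F)
  · exact hF.hasJointlyOntoSolutions_of_isOpen hMo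
  · exact hF.hasJointlyOntoSolutions_of_fewHoms (fewHoms_of_weight_lt hM hMo hw)

/-- The diamond theorem. -/
lemma IsSemiFree.hasJointlyOntoSolutions_of_inf_le (hF : IsSemiFree F)
    {M : Subgroup F} (hM : IsClosed (M : Set F)) {M₁ M₂ : Subgroup F}
    (hn₁ : M₁.Normal) (hn₂ : M₂.Normal) (hle : M₁ ⊓ M₂ ≤ M) (h₁ : ¬ M₁ ≤ M) (h₂ : ¬ M₂ ≤ M) :
    HasJointlyOntoSolutions M (rank F) := by
  by_cases hMo : IsOpen (M : Set F)
  · exact hF.hasJointlyOntoSolutions_of_isOpen hMo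
  · exact hF.hasJointlyOntoSolutions_of_diamond hM hMo hn₁ hn₂ hle h₁ h₂

/-- Proper subgroups of finite index of closed normal subgroups. -/
lemma IsSemiFree.hasJointlyOntoSolutions_of_lt_normal (hF : IsSemiFree F)
    {M N : Subgroup F} (hM : IsClosed (M : Set F)) (hN : N.Normal) (hlt : M < N)
    (hi : M.relIndex N ≠ 0) : HasJointlyOntoSolutions M (rank F) := by
  by_cases hMo : IsOpen (M : Set F)
  · exact hF.hasJointlyOntoSolutions_of_isOpen hMo
  have hfi : (M.subgroupOf N).FiniteIndex := ⟨hi⟩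
  -- `M` is open in `N`, so `N ⊓ U ≤ M` for some open normal `U`; since `M` is not open, `U` is not
  -- inside `M`, and the diamond theorem applies.
  obtain ⟨U, hUn, hU, hle⟩ := exists_openNormal_subgroupOf_le
    (Subgroup.isOpen_of_isClosed_of_finiteIndex (M.subgroupOf N)
      (hM.preimage continuous_subtype_val))
  exact hF.hasJointlyOntoSolutions_of_inf_le hM hN hUn (fun x hx => hle ⟨x, hx.1⟩ hx.2) hlt.not_ge
    fun h => hMo (Subgroup.isOpen_mono h hU)

/-- Closed normal subgroups with abelian quotient. -/
lemma IsSemiFree.hasJointlyOntoSolutions_of_abelian (hF : IsSemiFree F)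
    {M : Subgroup F} (hM : IsClosed (M : Set F)) [M.Normal] (hab : ∀ a b : F ⧸ M, a * b = b * a) :
    HasJointlyOntoSolutions M (rank F) := by
  by_cases htop : M = ⊤
  · exact hF.hasJointlyOntoSolutions_of_isOpen (by rw [htop]; exact isOpen_univ)
  obtain ⟨x, -, hx⟩ := SetLike.exists_of_lt (lt_top_iff_ne_top.2 htop)
  refine hF.hasJointlyOntoSolutions_of_commutator hM hx fun l => ?_
  rw [← QuotientGroup.eq_one_iff]
  rw [QuotientGroup.mk_mul, QuotientGroup.mk_mul, hab _ ((x⁻¹ : F) : F ⧸ M)]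
  simp

/-- In a finite nilpotent quotient the core for `p` maps into the Sylow `p`-subgroup, whose preimage
is normal of index prime to `p`; likewise for `q`. The two Sylow subgroups meet trivially. -/
lemma primeToCore_inf_le {N : Subgroup F} [N.Normal] (hN : IsClosed (N : Set F))
    (hnil : IsPronilpotent (F ⧸ N)) {p q : ℕ} (hp : p.Prime) (hq : q.Prime) (hpq : p ≠ q) :
    primeToCore N p ⊓ primeToCore N q ≤ N := by
  intro x hx
  refine mem_of_forall_isOpen hN fun V hV hNV => V.normalCore_le ?_
  have hVo := normalCore_isOpen hV
  have hNV' : N ≤ V.normalCore := Subgroup.normal_le_normalCore.2 hNV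
  have := finite_quotient_of_isOpen hVo
  have hmap : (V.normalCore.map (QuotientGroup.mk' N)).Normal :=
    Subgroup.Normal.map inferInstance _ (QuotientGroup.mk'_surjective N)
  have h1 := hnil (V.normalCore.map (QuotientGroup.mk' N)) (QuotientGroup.isOpenMap_coe _ hVo)
  have hnilp : Group.IsNilpotent (F ⧸ V.normalCore) :=
    Group.nilpotent_of_mulEquiv (QuotientGroup.quotientQuotientEquivQuotient N _ hNV')
  have := Fact.mk hp
  have := Fact.mk hq
  obtain ⟨P, P', hP, hP', hpP, hqP', hinf⟩ :=
    exists_normal_inf_eq_bot (Q := F ⧸ V.normalCore) hpq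
  have key : ∀ (r : ℕ) (R : Subgroup (F ⧸ V.normalCore)), R.Normal → ¬ r ∣ R.index →
      x ∈ primeToCore N r → (x : F ⧸ V.normalCore) ∈ R := by
    intro r R hR hr hxr
    have hle : V.normalCore ≤ R.comap (QuotientGroup.mk' V.normalCore) := fun y hy => by
      change (y : F ⧸ V.normalCore) ∈ R
      rw [(QuotientGroup.eq_one_iff y).2 hy]
      exact R.one_mem
    exact (Subgroup.mem_iInf.1 hxr) ⟨R.comap (QuotientGroup.mk' V.normalCore), inferInstance,
      Subgroup.isOpen_mono hle hVo, hNV'.trans hle, by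
        rwa [Subgroup.index_comap_of_surjective _ (QuotientGroup.mk'_surjective _)]⟩
  have h2 : (x : F ⧸ V.normalCore) ∈ P ⊓ P' := ⟨key p P hP hpP hx.1, key q P' hP' hqP' hx.2⟩
  rw [hinf, Subgroup.mem_bot] at h2
  exact (QuotientGroup.eq_one_iff x).1 h2

/-- The pronilpotent case. -/
lemma IsSemiFree.hasJointlyOntoSolutions_of_pronilpotent (hF : IsSemiFree F)
    {M N : Subgroup F} (hM : IsClosed (M : Set F)) [N.Normal] (hN : IsClosed (N : Set F))
    (hNM : N ≤ M) (hnil : IsPronilpotent (F ⧸ N)) {p q : Nat.Primes} (hpq : p ≠ q)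
    (hp : indexExponent M p ≠ 0) (hq : indexExponent M q ≠ 0) :
    HasJointlyOntoSolutions M (rank F) := by
  obtain ⟨U, hU, hMU, hd⟩ := exists_dvd_index_of_indexExponent_ne_zero hp
  obtain ⟨U', hU', hMU', hd'⟩ := exists_dvd_index_of_indexExponent_ne_zero hq
  exact hF.hasJointlyOntoSolutions_of_inf_le hM (primeToCore_normal N p) (primeToCore_normal N q)
    ((primeToCore_inf_le hN hnil p.2 q.2 fun h => hpq (Subtype.ext h)).trans hNM)
    (not_primeToCore_le p.2 hU hMU hd) (not_primeToCore_le q.2 hU' hMU' hd')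

/-- Sparse subgroups. -/
lemma IsSemiFree.hasJointlyOntoSolutions_of_isSparse (hF : IsSemiFree F) {M : Subgroup F}
    (hM : IsSparse M) : HasJointlyOntoSolutions M (rank F) := by
  rcases hF.1.lt_or_eq with hlt | heq
  · exact hF.hasJointlyOntoSolutions_of_weight_lt hM.1 (hM.weight_le.trans_lt hlt)
  have : CompactSpace M := isCompact_iff_compactSpace.1 hM.1.isCompact
  rw [← heq]
  refine hasJointlyOntoSolutions_aleph0 fun E hs hn => ?_
  obtain ⟨L₀, hLn, hLo, -, hL⟩ := exists_openNormal_le_of_embeddingProblem E (V := ⊤) isOpen_univ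
  obtain ⟨θ, hθ⟩ := exists_factor_subgroupMap (E.φ : M →* E.G) L₀ hL
  have hK₀ : IsOpen (((M.map (QuotientGroup.mk' L₀)).comap (QuotientGroup.mk' L₀) :
      Subgroup F) : Set F) := by
    refine Subgroup.isOpen_mono (fun x hx => ?_) hLo
    change (x : F ⧸ L₀) ∈ M.map (QuotientGroup.mk' L₀)
    rw [(QuotientGroup.eq_one_iff x).2 hx]
    exact Subgroup.one_mem _
  -- `K ≤ M L₀` lets the map to `G` extend from `M` to `K`, and the bound exceeds every index of a
  -- subgroup of `H`.
  obtain ⟨K, hK, hMK, hKle, hKL⟩ := hM.exists_le hK₀ (Subgroup.le_comap_map _ _)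
    (Nat.card E.H + 1)
  have hKc := Subgroup.isClosed_of_isOpen _ hK
  obtain ⟨hKsf, -⟩ := isSemiFree_of_forall_exists_jointlyOnto hF.1 rfl hKc
    (hF.hasJointlyOntoSolutions_of_isOpen hK)
  let φK : K →* E.G := θ.comp (((QuotientGroup.mk' L₀).comp K.subtype).codRestrict _
    fun x => hKle x.2)
  have hφK : ∀ x : M, φK (Subgroup.inclusion hMK x) = E.φ x := fun x => hθ x
  have hφc : Continuous φK := by
    refine continuous_of_continuousAt_one φK ?_
    rw [ContinuousAt, map_one, nhds_discrete E.G, Filter.tendsto_pure]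
    have e1 : ∀ᶠ x : K in nhds 1, x ∈ L₀.subgroupOf K :=
      (hLo.preimage continuous_subtype_val).mem_nhds (Subgroup.one_mem _)
    filter_upwards [e1] with x hx
    have h1 : (((QuotientGroup.mk' L₀).comp K.subtype).codRestrict
        (M.map (QuotientGroup.mk' L₀)) fun x => hKle x.2) x = 1 :=
      Subtype.ext ((QuotientGroup.eq_one_iff (x : F)).2 hx)
    change θ _ = 1
    rw [h1, map_one]
  let EK : FiniteEmbeddingProblem K :=
    { G := E.G
      H := E.H
      φ := ⟨φK, hφc⟩
      α := E.α
      φ_surjective := fun g => by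
        obtain ⟨x, hx⟩ := E.φ_surjective g
        exact ⟨Subgroup.inclusion hMK x, (hφK x).trans hx⟩
      α_surjective := E.α_surjective }
  obtain ⟨ι, ψ, hι, hp, -⟩ := hKsf.exists_jointlyOnto EK hs hn
  have : Nonempty ι := mk_ne_zero_iff.1 (hι ▸ (aleph0_pos.trans_le hKsf.1).ne')
  obtain ⟨i⟩ := this
  let χ : M →* E.H := (ψ i : K →* E.H).comp (Subgroup.inclusion hMK)
  have hχ : Continuous χ :=
    (ψ i).continuous_toFun.comp (continuous_subtype_val.subtype_mk fun x => hMK x.2)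
  refine ⟨⟨χ, hχ⟩, fun x => ((hp i).1 _).trans (hφK x), ?_⟩
  -- `X` contains `M` and its index in `K` is that of the image of `χ`, at most the order of `H`.
  -- Sparseness then forces `X = K`, so `χ` is onto.
  let X : Subgroup K := χ.range.comap (ψ i : K →* E.H)
  have hXo : IsOpen ((X.map K.subtype : Subgroup F) : Set F) :=
    hK.isOpenMap_subtype_val _
      ((isOpen_discrete (χ.range : Set E.H)).preimage (ψ i).continuous_toFun)
  have hMX : M ≤ X.map K.subtype := fun x hx =>
    ⟨⟨x, hMK hx⟩, ⟨⟨x, hx⟩, rfl⟩, rfl⟩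
  have hrel : (X.map K.subtype).relIndex K = χ.range.index := by
    have h1 : (X.map K.subtype).subgroupOf K = X :=
      Subgroup.comap_map_eq_self_of_injective K.subtype_injective X
    rw [Subgroup.relIndex, h1]
    exact Subgroup.index_comap_of_surjective _ (hp i).2
  have hle : X.map K.subtype ≤ K := Subgroup.map_subtype_le X
  have heqK : X.map K.subtype = K := by
    by_contra hne
    have h1 := hKL _ hXo hMX (lt_of_le_of_ne hle hne)
    have h2 : χ.range.index ≤ Nat.card E.H :=
      Nat.le_of_dvd Nat.card_pos (Subgroup.index_dvd_card _)
    omega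
  rw [heqK, Subgroup.relIndex_self] at hrel
  exact MonoidHom.range_eq_top.1 (Subgroup.index_eq_one.1 hrel.symm)

end SemiFree

theorem mainTheorem1 {F : Type u} [Group F] [TopologicalSpace F] [IsTopologicalGroup F]
    [CompactSpace F] [TotallyDisconnectedSpace F] (m : Cardinal.{u})
    (hF : SemiFree.IsSemiFree F) (hm : SemiFree.rank F = m)
    (M : Subgroup F) (hM : IsClosed (M : Set F))
    (hcases :
      -- (I)
      M.FiniteIndex ∨
      -- (II)
      SemiFree.TopologicallyFG (F ⧸ M.normalCore) ∨
      -- (III)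
      SemiFree.weight M < m ∨
      -- (IV)
      (∃ N : Subgroup F, N.Normal ∧ IsClosed (N : Set F) ∧ M < N ∧ M.relIndex N ≠ 0) ∨
      -- (V)
      (∃ _ : M.Normal, ∀ a b : F ⧸ M, a * b = b * a) ∨
      -- (VI)
      (∃ M₁ M₂ : Subgroup F, M₁.Normal ∧ IsClosed (M₁ : Set F) ∧
        M₂.Normal ∧ IsClosed (M₂ : Set F) ∧ M₁ ⊓ M₂ ≤ M ∧ ¬ M₁ ≤ M ∧ ¬ M₂ ≤ M) ∨
      -- (VII)
      ((∃ (N : Subgroup F) (_ : N.Normal), IsClosed (N : Set F) ∧ N ≤ M ∧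
          SemiFree.IsPronilpotent (F ⧸ N)) ∧
        ∃ p q : Nat.Primes, p ≠ q ∧
          SemiFree.indexExponent M p ≠ 0 ∧ SemiFree.indexExponent M q ≠ 0) ∨
      -- (VIII)
      SemiFree.IsSparse M ∨
      -- (IX)
      (∀ p : Nat.Primes, SemiFree.indexExponent M p < ⊤)) :
    SemiFree.IsSemiFree M ∧ SemiFree.rank M = m := by
  subst hm
  refine SemiFree.isSemiFree_of_forall_exists_jointlyOnto hF.1 rfl hM ?_
  rcases hcases with h | h | h | ⟨N, hN, -, hlt, hi⟩ | ⟨hn, hab⟩ | ⟨M₁, M₂, h₁, -, h₂, -, h⟩ |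
    ⟨⟨N, hN, hNc, hNM, hnil⟩, p, q, hpq, hp, hq⟩ | h | h
  · exact hF.hasJointlyOntoSolutions_of_isOpen (Subgroup.isOpen_of_isClosed_of_finiteIndex M hM)
  · exact hF.hasJointlyOntoSolutions_of_fewHoms (SemiFree.fewHoms_of_topologicallyFG h _)
  · exact hF.hasJointlyOntoSolutions_of_weight_lt hM h
  · exact hF.hasJointlyOntoSolutions_of_lt_normal hM hN hlt hi
  · exact hF.hasJointlyOntoSolutions_of_abelian hM hab
  · exact hF.hasJointlyOntoSolutions_of_inf_le hM h₁ h₂ h.1 h.2.1 h.2.2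
  · exact hF.hasJointlyOntoSolutions_of_pronilpotent hM hNc hNM hnil hpq hp hq
  · exact hF.hasJointlyOntoSolutions_of_isSparse h
  · by_cases hMi : M.FiniteIndex
    · exact hF.hasJointlyOntoSolutions_of_isOpen (Subgroup.isOpen_of_isClosed_of_finiteIndex M hM)
    · exact hF.hasJointlyOntoSolutions_of_isSparse
        (SemiFree.isSparse_of_indexExponent_lt_top hM hMi h)
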